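/- Let $M$ be a connected (Hausdorff, second countable, smooth) manifold of dimension $2k+1$. Let $X$ be a $t$-dependent vector field on $M$, and let $V^X$ be the smallest Lie algebra of vector fields on $M$ that contains all the $X_t$, $t\in\mathbb{R}$. Assume that $(M,V^X,X)$ is a locally automorphic Lie system: $V^X$ is finite-dimensional, $\dim V^X=\dim M$, and $\{Y_x : Y\in V^X\}=\mathrm{T}_xM$ for every $x\in M$. Let $e\colon\mathfrak g\to V^X$ be an isomorphism of real Lie algebras, let $(\delta\vartheta)(\xi,\zeta)=-\vartheta([\xi,\zeta])$ be the Chevalley–Eilenberg differential of $\vartheta\in\mathfrak g^*$, and put $$\Theta=\{\vartheta\in\mathfrak g^* : \vartheta\wedge(\delta\vartheta)^k\neq 0\}.$$ A one-form $\eta$ is a contact form if $\eta\wedge(\mathrm d\eta)^k$ vanishes nowhere; its Reeb vector field $R$ is given by $\eta(R)=1$, $i_R\mathrm d\eta=0$. A vector field $Y$ is Hamiltonian, with Hamiltonian function $h\in C^\infty$, if $i_Y\eta=-h$ and $i_Y\mathrm d\eta=\mathrm dh-(Rh)\eta$. For an open set $W\subseteq M$ let $\mathcal C(W)$ be the set of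 contact forms on $W$ for which all elements of $V^X$, restricted to $W$, are Hamiltonian, and let $\mathcal C_0(W)\subseteq\mathcal C(W)$ be the subset of those for which the Hamiltonian functions $h$ moreover satisfy $Rh=0$ (equivalently, the contact forms $\eta$ on $W$ with $\mathcal L_Y\eta=0$ for all $Y\in V^X$). For $x\in W$ let $\mathrm{ev}_x(\eta)\in\mathfrak g^*$ be given by $\mathrm{ev}_x(\eta)(\xi)=\eta_x(e(\xi)_x)$. Then: 1. If $M$ is simply connected, or if $M$ carries a Lie group structure whose right-invariant vector fields are exactly the elements of $V^X$, then $\mathrm{ev}_x\colon\mathcal C_0(M)\to\Theta$ is a bijection for every $x\in M$, and there is a bijection between $\mathcal C(M)$ and $\Theta$. 2. In general, every $x_0\in M$ has an open neighbourhood $U$ such that, for every non-empty connected open $W\subseteq U$, the map $\mathrm{ev}_x\colon\mathcal C_0(W)\to\Theta$ is a bijection for every $x\in W$, and there is a bijection between $\mathcal C(W)$ and $\Theta$. 3. In general, for every $x\in M$, $\mathrm{ev}_x$ maps $\mathcal C(M)$ into $\Theta$ and is injective on $\mathcal C_0(M)$. -/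

import Mathlib

open Set Bundle TopologicalSpace
open scoped Manifold ContDiff

/-! ### Multilinear algebra -/

section Algebra

variable {F : Type*} [AddCommGroup F] [Module ℝ F]

/-- The exterior product of real-valued alternating forms, `(α ∧ β)(v)` being the signed sum over
shuffles of products of values of `α` and `β`. -/
noncomputable def AlternatingMap.wedge {p q : ℕ} (α : F [⋀^Fin p]→ₗ[ℝ] ℝ)
    (β : F [⋀^Fin q]→ₗ[ℝ] ℝ) : F [⋀^Fin (p + q)]→ₗ[ℝ] ℝ :=
  ((LinearMap.mul' ℝ ℝ).compAlternatingMap (α.domCoprod β)).domDomCongr finSumFinEquiv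

/-- The `k`-fold exterior power `w ∧ ⋯ ∧ w` of a 2-form `w`. -/
noncomputable def AlternatingMap.wedgePow (w : F [⋀^Fin 2]→ₗ[ℝ] ℝ) :
    (k : ℕ) → F [⋀^Fin (2 * k)]→ₗ[ℝ] ℝ
  | 0 => AlternatingMap.constOfIsEmpty ℝ F (Fin 0) 1
  | k + 1 => (w.wedgePow k).wedge w

/-- The form `θ ∧ w ^ k`, for a linear form `θ` and a 2-form `w`. -/
noncomputable def contactTopForm (k : ℕ) (θ : F →ₗ[ℝ] ℝ) (w : F [⋀^Fin 2]→ₗ[ℝ] ℝ) :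
    F [⋀^Fin (1 + 2 * k)]→ₗ[ℝ] ℝ :=
  (AlternatingMap.ofSubsingleton ℝ F ℝ (0 : Fin 1) θ).wedge (w.wedgePow k)

variable {𝔤 : Type*} [LieRing 𝔤] [LieAlgebra ℝ 𝔤]

/-- The Chevalley–Eilenberg differential (trivial real coefficients) of a linear form,
`(δ ϑ)(ξ, ζ) = - ϑ [ξ, ζ]`, as an alternating 2-form. -/
def chevalleyEilenbergD (ϑ : Module.Dual ℝ 𝔤) : 𝔤 [⋀^Fin 2]→ₗ[ℝ] ℝ where
  toFun v := - ϑ ⁅v 0, v 1⁆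
  map_update_add' m i x y := by
    fin_cases i <;> simp <;> ring
  map_update_smul' m i c x := by
    fin_cases i <;> simp
  map_eq_zero_of_eq' v i j h hij := by
    have : v 0 = v 1 := by
      fin_cases i <;> fin_cases j <;> simp_all
    simp [this]

/-- `chevalleyEilenbergD` is Mathlib's coboundary of 1-cochains with values in the trivial
module `ℝ`. -/
theorem chevalleyEilenbergD_eq_d₁₂ (ϑ : Module.Dual ℝ 𝔤) (v : Fin 2 → 𝔤) :
    chevalleyEilenbergD ϑ v =
      TrivialLieModule.equiv ℝ 𝔤 ℝ (LieModule.Cohomology.d₁₂ ℝ 𝔤 (TrivialLieModule ℝ 𝔤 ℝ)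
        ((TrivialLieModule.equiv ℝ 𝔤 ℝ).symm.toLinearMap ∘ₗ ϑ) (v 0) (v 1)) := by
  rw [LieModule.Cohomology.d₁₂_apply_apply_ofTrivial]
  simp [chevalleyEilenbergD]

variable (𝔤) in
/-- The elements `ϑ` of `𝔤*` with `ϑ ∧ (δ ϑ) ^ k ≠ 0`. -/
def contactCovectors (k : ℕ) : Set (Module.Dual ℝ 𝔤) :=
  {ϑ | contactTopForm k ϑ (chevalleyEilenbergD ϑ) ≠ 0}

end Algebra

/-! ### Vector fields and one-forms -/

section Manifold

variable {E : Type*} [NormedAddCommGroup E] [NormedSpace ℝ E]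

section Basic

variable (E) (M : Type*) [TopologicalSpace M] [ChartedSpace E M] [IsManifold 𝓘(ℝ, E) ∞ M]

/-- Smooth vector fields on `M`. -/
abbrev SmoothVectorField : Type _ :=
  ContMDiffSection 𝓘(ℝ, E) E ∞ (fun x : M => TangentSpace 𝓘(ℝ, E) x)

/-- Smooth differential one-forms on `M`. -/
abbrev SmoothOneForm : Type _ :=
  ContMDiffSection 𝓘(ℝ, E) (E →L[ℝ] ℝ) ∞ (fun x : M => TangentSpace 𝓘(ℝ, E) x →L[ℝ] ℝ)

end Basic

theorem mfderiv_subtype_val {M : Type*} [TopologicalSpace M] [ChartedSpace E M] (W : Opens M)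
    (x : W) :
    mfderiv 𝓘(ℝ, E) 𝓘(ℝ, E) (Subtype.val : W → M) x = ContinuousLinearMap.id ℝ E := by
  have key : (chartAt E x.1 ∘ Subtype.val ∘ (chartAt E x).symm)
      =ᶠ[nhds (chartAt E x.1 x.1)] id := by
    filter_upwards [TopologicalSpace.Opens.chartAt_subtype_val_symm_eventuallyEq (H := E) W (x := x),
      (chartAt E x.1).open_target.mem_nhds (mem_chart_target E x.1)] with y hy hy'
    simp only [Function.comp_apply, id] at hy ⊢
    rw [← hy, (chartAt E x.1).right_inv hy']
  have h : HasMFDerivAt 𝓘(ℝ, E) 𝓘(ℝ, E) (Subtype.val : W → M) x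
      (ContinuousLinearMap.id ℝ E) := by
    refine ⟨continuous_subtype_val.continuousAt, ?_⟩
    simp only [mfld_simps]
    exact ((hasFDerivAt_id _).congr_of_eventuallyEq key).hasFDerivWithinAt
  exact h.mfderiv

variable {M : Type*} [TopologicalSpace M] [ChartedSpace E M] [IsManifold 𝓘(ℝ, E) ∞ M]

namespace SmoothVectorField

theorem contMDiff_mk {n : ℕ∞ω} (hn : n ≤ ∞) (Y : SmoothVectorField E M) :
    ContMDiff 𝓘(ℝ, E) 𝓘(ℝ, E).tangent n
      (fun x => (TotalSpace.mk' E x (Y x) : TangentBundle 𝓘(ℝ, E) M)) :=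
  Y.contMDiff.of_le hn

theorem mdifferentiableAt_mk (Y : SmoothVectorField E M) (x : M) :
    MDifferentiableAt 𝓘(ℝ, E) 𝓘(ℝ, E).tangent
      (fun x => (TotalSpace.mk' E x (Y x) : TangentBundle 𝓘(ℝ, E) M)) x :=
  Y.contMDiff.mdifferentiableAt (by simp)

variable [CompleteSpace E]

/-- The Lie bracket of smooth vector fields. -/
noncomputable instance : Bracket (SmoothVectorField E M) (SmoothVectorField E M) where
  bracket Y Z :=
    { toFun := VectorField.mlieBracket 𝓘(ℝ, E) Y Z
      contMDiff_toFun := by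
        have : IsManifold 𝓘(ℝ, E) (((⊤ : ℕ∞) : ℕ∞ω) + 1) M := by
          simpa using (inferInstance : IsManifold 𝓘(ℝ, E) ∞ M)
        have : IsManifold 𝓘(ℝ, E) (minSmoothness ℝ 2) M := by
          rw [minSmoothness_of_isRCLikeNormedField]; infer_instance
        have : IsManifold 𝓘(ℝ, E) (minSmoothness ℝ 3) M := by
          rw [minSmoothness_of_isRCLikeNormedField]; infer_instance
        exact ContDiff.mlieBracket_vectorField (m := ⊤) (n := ⊤) Y.contMDiff Z.contMDiff
          (by simp) }

@[simp]
theorem bracket_apply (Y Z : SmoothVectorField E M) (x : M) :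
    ⁅Y, Z⁆ x = VectorField.mlieBracket 𝓘(ℝ, E) Y Z x := rfl

noncomputable instance : LieRing (SmoothVectorField E M) where
  add_lie Y Z W := by
    ext x
    exact VectorField.mlieBracket_add_left (Y.mdifferentiableAt_mk x) (Z.mdifferentiableAt_mk x)
  lie_add Y Z W := by
    ext x
    exact VectorField.mlieBracket_add_right (Z.mdifferentiableAt_mk x) (W.mdifferentiableAt_mk x)
  lie_self Y := by
    ext x
    simp
  leibniz_lie Y Z W := by
    ext x
    have : IsManifold 𝓘(ℝ, E) (minSmoothness ℝ 3) M := by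
      rw [minSmoothness_of_isRCLikeNormedField]; infer_instance
    have h2 : minSmoothness ℝ 2 ≤ ∞ := by
      rw [minSmoothness_of_isRCLikeNormedField]
      exact WithTop.coe_le_coe.2 (le_top : (2 : ℕ∞) ≤ ⊤)
    exact VectorField.leibniz_identity_mlieBracket_apply (Y.contMDiff_mk h2 x)
      (Z.contMDiff_mk h2 x) (W.contMDiff_mk h2 x)

noncomputable instance : LieAlgebra ℝ (SmoothVectorField E M) where
  lie_smul c Y Z := by
    ext x
    exact VectorField.mlieBracket_const_smul_right (Z.mdifferentiableAt_mk x)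

/-- The restriction of a smooth vector field to an open subset. -/
noncomputable def restrict (W : Opens M) (Y : SmoothVectorField E M) :
    SmoothVectorField E W where
  toFun := VectorField.mpullback 𝓘(ℝ, E) 𝓘(ℝ, E) (Subtype.val : W → M) Y
  contMDiff_toFun := by
    refine ContMDiff.mpullback_vectorField (n := ∞) Y.contMDiff contMDiff_subtype_val ?_ (by simp)
    intro x
    rw [mfderiv_subtype_val]
    exact ⟨ContinuousLinearEquiv.refl ℝ E, rfl⟩

end SmoothVectorField

/-- The exterior derivative of a one-form at `x`: the form is written in the preferred chart at `x`,
differentiated there, and the result is transported back to `T_x M`. -/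
noncomputable def oneFormExtDeriv (η : SmoothOneForm E M) (x : M) :
    TangentSpace 𝓘(ℝ, E) x [⋀^Fin 2]→ₗ[ℝ] ℝ :=
  (extDeriv (fun y : E => ContinuousAlternatingMap.ofSubsingleton ℝ E ℝ (0 : Fin 1)
      ((η ((extChartAt 𝓘(ℝ, E) x).symm y)).comp
        (mfderiv 𝓘(ℝ, E) 𝓘(ℝ, E) (extChartAt 𝓘(ℝ, E) x).symm y)))
    (extChartAt 𝓘(ℝ, E) x x)).toAlternatingMap.compLinearMap
      (mfderiv 𝓘(ℝ, E) 𝓘(ℝ, E) (extChartAt 𝓘(ℝ, E) x) x).toLinearMap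

/-! ### Contact geometry -/

/-- `η` is a contact form on a manifold of dimension `2 k + 1`: `η ∧ (dη) ^ k` vanishes nowhere. -/
def IsContactForm (k : ℕ) (η : SmoothOneForm E M) : Prop :=
  ∀ x, contactTopForm k (η x).toLinearMap (oneFormExtDeriv η x) ≠ 0

/-- `r : T_x M` is the value at `x` of the Reeb vector field: `η (r) = 1` and `i_r dη = 0`.
For a contact form these conditions determine `r`. -/
def IsReebVector (η : SmoothOneForm E M) (x : M) (r : TangentSpace 𝓘(ℝ, E) x) : Prop :=
  η x r = 1 ∧ ∀ v, oneFormExtDeriv η x ![r, v] = 0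

/-- The differential of a real function, as a linear form on `T_x M`. -/
noncomputable def differentialAt (h : M → ℝ) (x : M) : TangentSpace 𝓘(ℝ, E) x →L[ℝ] ℝ :=
  mfderiv 𝓘(ℝ, E) 𝓘(ℝ, ℝ) h x

/-- `Y` is the contact Hamiltonian vector field of the smooth function `h` relative to `η`:
`i_Y η = -h` and `i_Y dη = dh - (R h) η`, with `R` the Reeb vector field. -/
def IsContactHamiltonian (η : SmoothOneForm E M) (Y : SmoothVectorField E M) (h : M → ℝ) : Prop :=
  ContMDiff 𝓘(ℝ, E) 𝓘(ℝ, ℝ) ∞ h ∧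
  ∀ x, ∃ r, IsReebVector η x r ∧ η x (Y x) = - h x ∧
    ∀ v : TangentSpace 𝓘(ℝ, E) x, oneFormExtDeriv η x ![Y x, v] =
      differentialAt h x v - differentialAt h x r * η x v

/-- `h` is a first integral of the Reeb vector field of `η`. -/
def IsReebFirstIntegral (η : SmoothOneForm E M) (h : M → ℝ) : Prop :=
  ∀ x r, IsReebVector η x r → differentialAt h x r = 0

/-- The contact forms for which all vector fields in `S` are Hamiltonian. -/
def hamiltonianContactForms (k : ℕ) (S : Set (SmoothVectorField E M)) :
    Set (SmoothOneForm E M) :=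
  {η | IsContactForm k η ∧ ∀ Y ∈ S, ∃ h, IsContactHamiltonian η Y h}

/-- The contact forms for which all vector fields in `S` are Hamiltonian, with Hamiltonian
functions that are first integrals of the Reeb vector field. -/
def conservativeContactForms (k : ℕ) (S : Set (SmoothVectorField E M)) :
    Set (SmoothOneForm E M) :=
  {η | IsContactForm k η ∧ ∀ Y ∈ S, ∃ h, IsContactHamiltonian η Y h ∧ IsReebFirstIntegral η h}

/-- For a linear map `ρ` from `𝔤` to vector fields, the linear form `ξ ↦ η_x (ρ(ξ)_x)` on `𝔤`. -/
noncomputable def evalCovector {𝔤 : Type*} [AddCommGroup 𝔤] [Module ℝ 𝔤]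
    (ρ : 𝔤 →ₗ[ℝ] SmoothVectorField E M) (x : M) (η : SmoothOneForm E M) : Module.Dual ℝ 𝔤 where
  toFun ξ := η x (ρ ξ x)
  map_add' ξ ζ := by simp
  map_smul' c ξ := by simp

/-! ### Lie systems -/

section LieSystem

variable [CompleteSpace E]

/-- The restriction of vector fields to an open subset, as a linear map. -/
noncomputable def restrictₗ (W : Opens M) :
    SmoothVectorField E M →ₗ[ℝ] SmoothVectorField E W where
  toFun := SmoothVectorField.restrict W
  map_add' Y Z := by
    ext x
    simp [SmoothVectorField.restrict, VectorField.mpullback]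
  map_smul' c Y := by
    ext x
    simp [SmoothVectorField.restrict, VectorField.mpullback]

/-- The set of restrictions to an open subset of the vector fields in `V`. -/
def restrictSet (W : Opens M) (V : LieSubalgebra ℝ (SmoothVectorField E M)) :
    Set (SmoothVectorField E W) :=
  restrictₗ W '' V

/-- The smallest Lie algebra `V^X` of a time-dependent vector field `X`. -/
noncomputable def smallestLieAlgebra (X : ℝ → SmoothVectorField E M) :
    LieSubalgebra ℝ (SmoothVectorField E M) :=
  LieSubalgebra.lieSpan ℝ (SmoothVectorField E M) (range X)

/-- A Lie algebra isomorphism from `𝔤` onto `V^X`, viewed as a linear map from `𝔤` to the vector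
fields on `M`. -/
noncomputable def realization {𝔤 : Type*} [LieRing 𝔤] [LieAlgebra ℝ 𝔤]
    {X : ℝ → SmoothVectorField E M} (e : 𝔤 ≃ₗ⁅ℝ⁆ smallestLieAlgebra X) :
    𝔤 →ₗ[ℝ] SmoothVectorField E M where
  toFun ξ := e ξ
  map_add' ξ ζ := by simp
  map_smul' c ξ := by simp

/-- `(M, X, V)` is a locally automorphic Lie system: `V` is a Vessiot–Guldberg Lie algebra of `X`
(a finite-dimensional Lie algebra of vector fields containing all the `X t`) with
`dim V = dim M` whose associated distribution is `TM`. -/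
structure IsLocallyAutomorphic (X : ℝ → SmoothVectorField E M)
    (V : LieSubalgebra ℝ (SmoothVectorField E M)) : Prop where
  finiteDimensional : FiniteDimensional ℝ V
  mem : ∀ t, X t ∈ V
  finrank_eq : Module.finrank ℝ V = Module.finrank ℝ E
  distribution_eq : ∀ (x : M) (v : TangentSpace 𝓘(ℝ, E) x), ∃ Y ∈ V, Y x = v

/-- `Y` is a right-invariant vector field on the Lie group `M`. -/
def IsRightInvariantField [Group M] (Y : SmoothVectorField E M) : Prop :=
  ∀ g h : M, mfderiv 𝓘(ℝ, E) 𝓘(ℝ, E) (fun m : M => m * g) h (Y h) = Y (h * g)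

/-- For some Lie group structure on the manifold `M`, the elements of `V` are exactly the
right-invariant vector fields. -/
def IsRightInvariantAlgebra (V : LieSubalgebra ℝ (SmoothVectorField E M)) : Prop :=
  ∃ (_ : Group M) (_ : LieGroup 𝓘(ℝ, E) ∞ M), ∀ Y, Y ∈ V ↔ IsRightInvariantField Y

end LieSystem

end Manifold

/-! ### Local systems -/

section LocalSystem

open Filter Topology

/-- A locally constant property which holds somewhere in a preconnected space holds everywhere. -/
theorem forall_of_locally_propagating {X : Type*} [TopologicalSpace X] [PreconnectedSpace X]
    {P : X → Prop} (h : ∀ x, ∃ U ∈ 𝓝 x, ∀ y ∈ U, ∀ z ∈ U, P y → P z) {x₀ : X} (h₀ : P x₀) (x : X) :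
    P x := by
  have hc : IsClopen {x | P x} := by
    constructor
    · rw [← isOpen_compl_iff, isOpen_iff_mem_nhds]
      intro y hy
      obtain ⟨U, hU, h⟩ := h y
      filter_upwards [hU] with z hz hz'
      exact hy (h z hz y (mem_of_mem_nhds hU) hz')
    · rw [isOpen_iff_mem_nhds]
      intro y hy
      obtain ⟨U, hU, h⟩ := h y
      filter_upwards [hU] with z hz
      exact h y (mem_of_mem_nhds hU) z hz hy
  have := hc.eq_univ ⟨x₀, h₀⟩
  exact this.ge (mem_univ x)

variable {X F : Type*} [TopologicalSpace X]

/-- On the open connected set `U`, a section (a function satisfying `S`) is determined by its value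
at an arbitrary point, and this value can be prescribed. -/
structure IsTrivializedOn (S : (X → F) → X → Prop) (U : Set X) : Prop where
  isOpen : IsOpen U
  isPreconnected : IsPreconnected U
  exists_section : ∀ x ∈ U, ∀ a, ∃ u, u x = a ∧ ∀ y ∈ U, S u y
  eqOn : ∀ u v, (∀ y ∈ U, S u y) → (∀ y ∈ U, S v y) → ∀ x ∈ U, u x = v x → EqOn u v U

/-- The sections (functions satisfying the local condition `S`) form a local system. -/
structure IsLocalSystem (S : (X → F) → X → Prop) : Prop where
  congr : ∀ u v x, u =ᶠ[𝓝 x] v → S u x → S v x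
  trivialized : ∀ x, ∀ N ∈ 𝓝 x, ∃ U ⊆ N, x ∈ U ∧ IsTrivializedOn S U

namespace IsLocalSystem

variable {S : (X → F) → X → Prop} (hS : IsLocalSystem S)
include hS

theorem eventuallyEq {u v : X → F} {x : X} (hu : ∀ᶠ y in 𝓝 x, S u y) (hv : ∀ᶠ y in 𝓝 x, S v y)
    (h : u x = v x) : u =ᶠ[𝓝 x] v := by
  obtain ⟨U, hU, hx, hT⟩ := hS.trivialized x _ (hu.and hv)
  exact (hT.eqOn u v (fun y hy => (hU hy).1) (fun y hy => (hU hy).2) x hx h).eventuallyEq_of_mem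
    (hT.isOpen.mem_nhds hx)

theorem eq_of_eq_at [PreconnectedSpace X] {u v : X → F} (hu : ∀ y, S u y) (hv : ∀ y, S v y)
    {x : X} (h : u x = v x) : u = v := by
  funext y
  refine forall_of_locally_propagating (P := fun y => u y = v y) (fun z => ?_) h y
  obtain ⟨U, -, hx, hT⟩ := hS.trivialized z univ univ_mem
  exact ⟨U, hT.isOpen.mem_nhds hx, fun y hy w hw hyw =>
    hT.eqOn u v (fun y _ => hu y) (fun y _ => hv y) y hy hyw hw⟩

/-- A local system on a simply connected, locally path connected space is trivial. -/
theorem exists_section_of_simplyConnectedSpace [SimplyConnectedSpace X]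
    [LocallyPathConnectedSpace X] (x₀ : X) (a₀ : F) : ∃ u, u x₀ = a₀ ∧ ∀ y, S u y := by
  choose U _ mem hU using fun x => hS.trivialized x univ univ_mem
  have : ∀ j x a, ∃ u : X → F, x ∈ U j → u x = a ∧ ∀ y ∈ U j, S u y := by
    intro j x a
    by_cases hx : x ∈ U j
    · obtain ⟨u, hu⟩ := (hU j).exists_section x hx a
      exact ⟨u, fun _ => hu⟩
    · exact ⟨fun _ => a, fun h => absurd h hx⟩
  choose sol hsol using this
  have sol_eq : ∀ j x a, ∀ u : X → F, x ∈ U j → (∀ y ∈ U j, S u y) → u x = a →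
      ∀ y ∈ U j, sol j x a y = u y := fun j x a u hx hu hux =>
    (hU j).eqOn _ _ (hsol j x a hx).2 hu x hx ((hsol j x a hx).1.trans hux.symm)
  let _ : TopologicalSpace F := ⊥
  have : DiscreteTopology F := ⟨rfl⟩
  let Z : FiberBundleCore X X F :=
    { baseSet := U
      isOpen_baseSet := fun j => (hU j).isOpen
      indexAt := id
      mem_baseSet_at := mem
      coordChange := fun i j x a => sol j x (sol i i a x) j
      coordChange_self := by
        intro i x hx v
        rw [sol_eq i x _ (sol i i v) hx (hsol i i v (mem i)).2 rfl i (mem i)]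
        exact (hsol i i v (mem i)).1
      continuousOn_coordChange := by
        rintro i j ⟨x, v⟩ ⟨⟨hi, hj⟩, -⟩
        apply ContinuousAt.continuousWithinAt
        have h1 := hsol j x (sol i i v x) hj
        have h2 : sol j x (sol i i v x) =ᶠ[𝓝 x] sol i i v :=
          hS.eventuallyEq (eventually_of_mem ((hU j).isOpen.mem_nhds hj) h1.2)
            (eventually_of_mem ((hU i).isOpen.mem_nhds hi) (hsol i i v (mem i)).2) h1.1
        refine tendsto_nhds_of_eventually_eq ?_
        rw [nhds_prod_eq, nhds_discrete F, prod_pure, eventually_map]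
        filter_upwards [h2, (hU j).isOpen.mem_nhds hj] with y hy hy'
        exact sol_eq j y _ _ hy' h1.2 hy j (mem j)
      coordChange_comp := by
        rintro i j k x ⟨⟨hi, hj⟩, hk⟩ v
        have h1 := hsol j x (sol i i v x) hj
        have := sol_eq j j _ _ (mem j) h1.2 rfl x hj
        simp only [this, h1.1] }
  have hcov : IsCoveringMap (π F Z.Fiber) := FiberBundle.isCoveringMap
  obtain ⟨s, ⟨hs0, hs⟩, -⟩ := hcov.existsUnique_continuousMap_lifts (ContinuousMap.id X) x₀
    ⟨x₀, a₀⟩ rfl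
  have hs' : ∀ y, (s y).1 = y := fun y => congrFun hs y
  let val : Z.TotalSpace → F := fun p => p.2
  let u : X → F := fun y => val (s y)
  refine ⟨u, congrArg val hs0, fun y => ?_⟩
  have hc : ContinuousAt (fun z => (Z.localTriv y (s z)).2) y := by
    have : ContinuousAt (Z.localTriv y) (s y) := by
      apply (Z.localTriv y).continuousAt
      rw [FiberBundleCore.mem_localTriv_source, hs' y]
      exact mem y
    exact (continuous_snd.continuousAt.comp this).comp s.continuous.continuousAt
  have hval : ∀ z, (Z.localTriv y (s z)).2 = sol y z (u z) y := by
    intro z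
    have : (Z.localTriv y (s z)).2 = sol y (s z).1 (sol (s z).1 (s z).1 (u z) (s z).1) y := rfl
    rw [this, (hsol _ _ _ (mem _)).1, hs' z]
  rw [ContinuousAt, nhds_discrete F, tendsto_pure] at hc
  refine hS.congr (sol y y (u y)) u y ?_ ((hsol y y (u y) (mem y)).2 y (mem y))
  filter_upwards [hc, (hU y).isOpen.mem_nhds (mem y)] with z hz hz'
  rw [hval, hval] at hz
  rw [(hsol y y (u y) (mem y)).1] at hz
  have h1 := hsol y z (u z) hz'
  rw [← h1.1]
  exact sol_eq y y (u y) _ (mem y) h1.2 hz z hz'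

end IsLocalSystem

end LocalSystem

/-! ### Exterior algebra -/

section ExteriorAlgebra

variable {F G : Type*} [AddCommGroup F] [Module ℝ F] [AddCommGroup G] [Module ℝ G]

namespace AlternatingMap

variable {p q : ℕ}

/-- The summand of a wedge product belonging to a permutation. -/
theorem mul'_domCoprod_summand_mk (α : F [⋀^Fin p]→ₗ[ℝ] ℝ) (β : F [⋀^Fin q]→ₗ[ℝ] ℝ)
    (σ : Equiv.Perm (Fin p ⊕ Fin q)) (v : Fin p ⊕ Fin q → F) :
    LinearMap.mul' ℝ ℝ (domCoprod.summand α β (Quotient.mk'' σ) v) =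
      Equiv.Perm.sign σ • (α (fun i => v (σ (Sum.inl i))) * β (fun i => v (σ (Sum.inr i)))) := by
  rw [domCoprod.summand_mk'']
  rcases Int.units_eq_one_or (Equiv.Perm.sign σ) with h | h <;>
    simp [h, MultilinearMap.domCoprod_apply]

theorem wedge_apply (α : F [⋀^Fin p]→ₗ[ℝ] ℝ) (β : F [⋀^Fin q]→ₗ[ℝ] ℝ) (v : Fin (p + q) → F) :
    α.wedge β v = ∑ σ : Equiv.Perm.ModSumCongr (Fin p) (Fin q),
      LinearMap.mul' ℝ ℝ (domCoprod.summand α β σ (fun i => v (finSumFinEquiv i))) := by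
  simp only [wedge, domDomCongr_apply, LinearMap.compAlternatingMap_apply, domCoprod_apply,
    _root_.sum_apply, map_sum]
  rfl

theorem wedge_compLinearMap (α : F [⋀^Fin p]→ₗ[ℝ] ℝ) (β : F [⋀^Fin q]→ₗ[ℝ] ℝ) (f : G →ₗ[ℝ] F) :
    (α.wedge β).compLinearMap f = (α.compLinearMap f).wedge (β.compLinearMap f) := by
  ext v
  rw [compLinearMap_apply, wedge_apply, wedge_apply]
  refine Finset.sum_congr rfl fun σ _ => ?_
  induction σ using Quotient.inductionOn' with | _ σ
  simp only [mul'_domCoprod_summand_mk, compLinearMap_apply]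

theorem smul_wedge_smul (c d : ℝ) (α : F [⋀^Fin p]→ₗ[ℝ] ℝ) (β : F [⋀^Fin q]→ₗ[ℝ] ℝ) :
    (c • α).wedge (d • β) = (c * d) • α.wedge β := by
  ext v
  rw [smul_apply, wedge_apply, wedge_apply, Finset.smul_sum]
  refine Finset.sum_congr rfl fun σ _ => ?_
  induction σ using Quotient.inductionOn' with | _ σ
  rw [mul'_domCoprod_summand_mk, mul'_domCoprod_summand_mk]
  simp only [smul_apply, smul_eq_mul]
  rcases Int.units_eq_one_or (Equiv.Perm.sign σ) with h | h <;> simp [h] <;> ring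

theorem wedgePow_compLinearMap (w : F [⋀^Fin 2]→ₗ[ℝ] ℝ) (f : G →ₗ[ℝ] F) (k : ℕ) :
    (w.wedgePow k).compLinearMap f = (w.compLinearMap f).wedgePow k := by
  induction k with
  | zero => ext v; simp [wedgePow]
  | succ k ih => simp only [wedgePow, ← ih]; exact wedge_compLinearMap _ _ f

theorem smul_wedgePow (c : ℝ) (w : F [⋀^Fin 2]→ₗ[ℝ] ℝ) (k : ℕ) :
    (c • w).wedgePow k = c ^ k • w.wedgePow k := by
  induction k with
  | zero => simp [wedgePow]
  | succ k ih => simp only [wedgePow, ih, pow_succ]; exact smul_wedge_smul _ _ _ _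

/-- `θ ∧ α` depends only on the restriction of `α` to the kernel of `θ`. -/
theorem ofSubsingleton_wedge_congr [FiniteDimensional ℝ F] (θ : F →ₗ[ℝ] ℝ)
    {α β : F [⋀^Fin q]→ₗ[ℝ] ℝ}
    (h : α.compLinearMap θ.ker.subtype = β.compLinearMap θ.ker.subtype) :
    (ofSubsingleton ℝ F ℝ (0 : Fin 1) θ).wedge α =
      (ofSubsingleton ℝ F ℝ (0 : Fin 1) θ).wedge β := by
  rcases eq_or_ne θ 0 with rfl | hθ
  · ext v
    rw [wedge_apply, wedge_apply]
    refine Finset.sum_congr rfl fun σ _ => ?_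
    induction σ using Quotient.inductionOn' with | _ σ
    rw [mul'_domCoprod_summand_mk, mul'_domCoprod_summand_mk]
    simp
  obtain ⟨ξ, hξ⟩ : ∃ ξ, θ ξ = 1 := by
    obtain ⟨ζ, hζ⟩ := DFunLike.ne_iff.1 hθ
    exact ⟨(θ ζ)⁻¹ • ζ, by simpa using inv_mul_cancel₀ hζ⟩
  let b := Module.Basis.mkFinCons ξ (Module.finBasis ℝ θ.ker)
    (by
      intro c x hx h
      have := congrArg θ h
      rw [LinearMap.mem_ker] at hx
      simpa [hξ, hx] using this)
    (fun z => ⟨-θ z, by simp [hξ]⟩)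
  refine Module.Basis.ext_alternating b fun v hv => ?_
  rw [wedge_apply, wedge_apply]
  refine Finset.sum_congr rfl fun σ _ => ?_
  induction σ using Quotient.inductionOn' with | _ σ
  rw [mul'_domCoprod_summand_mk, mul'_domCoprod_summand_mk]
  congr 1
  have hb : ∀ i, i ≠ 0 → b i ∈ θ.ker := by
    intro i hi
    obtain ⟨j, rfl⟩ := Fin.exists_succ_eq.2 hi
    simp [b, Module.Basis.coe_mkFinCons]
  by_cases h0 : v (finSumFinEquiv (σ (Sum.inl 0))) = 0
  · congr 1
    have h1 : ∀ i : Fin q, b (v (finSumFinEquiv (σ (Sum.inr i)))) ∈ θ.ker := by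
      intro i
      apply hb
      rw [← h0]
      intro he
      simpa using σ.injective (finSumFinEquiv.injective (hv he))
    exact DFunLike.congr_fun h (fun i => ⟨_, h1 i⟩)
  · have := hb _ h0
    rw [LinearMap.mem_ker] at this
    simp [this]

end AlternatingMap

open AlternatingMap

theorem contactTopForm_compLinearMap (k : ℕ) (θ : F →ₗ[ℝ] ℝ) (w : F [⋀^Fin 2]→ₗ[ℝ] ℝ)
    (f : G →ₗ[ℝ] F) : (contactTopForm k θ w).compLinearMap f =
      contactTopForm k (θ ∘ₗ f) (w.compLinearMap f) := by
  simp only [contactTopForm]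
  rw [wedge_compLinearMap, wedgePow_compLinearMap]
  rfl

theorem contactTopForm_smul (k : ℕ) (c d : ℝ) (θ : F →ₗ[ℝ] ℝ) (w : F [⋀^Fin 2]→ₗ[ℝ] ℝ) :
    contactTopForm k (c • θ) (d • w) = (c * d ^ k) • contactTopForm k θ w := by
  simp only [contactTopForm, smul_wedgePow, ← smul_wedge_smul]
  congr 1

/-- `θ ∧ w ^ k` depends only on the restriction of `w` to the kernel of `θ`. -/
theorem contactTopForm_congr [FiniteDimensional ℝ F] (k : ℕ) {θ : F →ₗ[ℝ] ℝ}
    {w w' : F [⋀^Fin 2]→ₗ[ℝ] ℝ}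
    (h : ∀ x y, θ x = 0 → θ y = 0 → w ![x, y] = w' ![x, y]) :
    contactTopForm k θ w = contactTopForm k θ w' := by
  refine ofSubsingleton_wedge_congr θ ?_
  rw [wedgePow_compLinearMap, wedgePow_compLinearMap]
  congr 1
  ext v
  have := h (v 0) (v 1) (v 0).2 (v 1).2
  simp only [compLinearMap_apply]
  convert this using 2 <;>
  · ext i
    fin_cases i <;> rfl

theorem contactTopForm_zero_left (k : ℕ) (w : F [⋀^Fin 2]→ₗ[ℝ] ℝ) : contactTopForm k 0 w = 0 := by
  simpa using contactTopForm_smul k 0 1 0 w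

section Lie

variable {𝔤 : Type*} [LieRing 𝔤] [LieAlgebra ℝ 𝔤]

theorem smul_mem_contactCovectors {k : ℕ} {ϑ : Module.Dual ℝ 𝔤} (h : ϑ ∈ contactCovectors 𝔤 k)
    {c : ℝ} (hc : c ≠ 0) : c • ϑ ∈ contactCovectors 𝔤 k := by
  have : chevalleyEilenbergD (c • ϑ) = c • chevalleyEilenbergD ϑ := by
    ext v
    simp [chevalleyEilenbergD]
  simp only [contactCovectors, mem_ofPred_eq, this] at h ⊢
  have h2 := contactTopForm_smul k c c ϑ (chevalleyEilenbergD ϑ)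
  intro h3
  rw [h3] at h2
  exact (smul_ne_zero (mul_ne_zero hc (pow_ne_zero k hc)) h) h2.symm

/-- If a 2-form `w` on a vector space identified with `𝔤` agrees with `-δϑ` on the kernel of `ϑ`,
then `ϑ ∧ w ^ k` vanishes exactly when `ϑ ∧ (δ ϑ) ^ k` does. -/
theorem contactTopForm_ne_zero_iff [FiniteDimensional ℝ 𝔤] (k : ℕ) (f : 𝔤 ≃ₗ[ℝ] F)
    {θ : F →ₗ[ℝ] ℝ} {w : F [⋀^Fin 2]→ₗ[ℝ] ℝ}
    (h : ∀ ξ ζ, θ (f ξ) = 0 → θ (f ζ) = 0 → w ![f ξ, f ζ] = θ (f ⁅ξ, ζ⁆)) :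
    contactTopForm k θ w ≠ 0 ↔ θ ∘ₗ f.toLinearMap ∈ contactCovectors 𝔤 k := by
  set ϑ : Module.Dual ℝ 𝔤 := θ ∘ₗ f.toLinearMap with hϑ
  have h1 : (contactTopForm k θ w).compLinearMap f.toLinearMap =
      ((-1 : ℝ) ^ k) • contactTopForm k ϑ (chevalleyEilenbergD ϑ) := by
    rw [contactTopForm_compLinearMap]
    have := contactTopForm_smul k 1 (-1) ϑ (chevalleyEilenbergD ϑ)
    rw [one_mul, one_smul] at this
    rw [← this]
    refine contactTopForm_congr k fun x y hx hy => ?_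
    have h2 := h x y hx hy
    have h3 : (fun i => f ((![x, y] : Fin 2 → 𝔤) i)) = ![f x, f y] := by
      ext i
      fin_cases i <;> rfl
    simp only [compLinearMap_apply, chevalleyEilenbergD, AlternatingMap.smul_apply]
    simp only [LinearEquiv.coe_coe, h3, h2, hϑ]
    simp
  have h2 : contactTopForm k θ w = 0 ↔
      (contactTopForm k θ w).compLinearMap f.toLinearMap = 0 := by
    constructor
    · intro h; rw [h, zero_compLinearMap]
    · intro h
      ext v
      have := DFunLike.congr_fun h (fun i => f.symm (v i))
      simpa using this
  rw [Ne, h2, h1, smul_eq_zero_iff_right (pow_ne_zero k (by norm_num))]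
  rfl

/-- Pulling back along a linear map which preserves `ϑ` and its differential. -/
theorem mem_contactCovectors_of_comp (k : ℕ) (f : 𝔤 →ₗ[ℝ] 𝔤) {ϑ ϑ' : Module.Dual ℝ 𝔤}
    (h : ∀ ξ, ϑ' (f ξ) = ϑ ξ) (h' : ∀ ξ ζ, ϑ' ⁅f ξ, f ζ⁆ = ϑ ⁅ξ, ζ⁆)
    (hϑ : ϑ ∈ contactCovectors 𝔤 k) : ϑ' ∈ contactCovectors 𝔤 k := by
  intro h0
  apply hϑ
  have h1 : ϑ' ∘ₗ f = ϑ := LinearMap.ext h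
  have h2 : (chevalleyEilenbergD ϑ').compLinearMap f = chevalleyEilenbergD ϑ := by
    ext v
    exact congrArg Neg.neg (h' (v 0) (v 1))
  have h3 := contactTopForm_compLinearMap k ϑ' (chevalleyEilenbergD ϑ') f
  rw [h0, h1, h2, zero_compLinearMap] at h3
  exact h3.symm

end Lie

end ExteriorAlgebra

/-! ### Flat linear connections -/

section FlatConnection

open Metric Filter Topology

variable {E F : Type*} [NormedAddCommGroup E] [NormedSpace ℝ E] [NormedAddCommGroup F]
  [NormedSpace ℝ F]

theorem norm_le_of_norm_deriv_le {f f' : ℝ → F} {ε : ℝ} (hε : 0 ≤ ε) (h0 : f 0 = 0)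
    (hf : ∀ t ∈ Icc (0 : ℝ) 1, HasDerivWithinAt f (f' t) (Icc 0 1) t)
    (bound : ∀ t ∈ Icc (0 : ℝ) 1, ‖f' t‖ ≤ ‖f t‖ + ε) : ∀ t ∈ Icc (0 : ℝ) 1, ‖f t‖ ≤ 2 * ε := by
  intro t ht
  have h := norm_le_gronwallBound_of_norm_deriv_right_le (f := f) (f' := f') (δ := 0) (K := 1)
    (ε := ε) (a := 0) (b := 1) (fun t ht => (hf t ht).continuousWithinAt)
    (fun t ht => (hf t (Ico_subset_Icc_self ht)).mono_of_mem_nhdsWithin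
      (Icc_mem_nhdsGE_of_mem ht)) (by simp [h0])
    (fun t ht => by simpa using bound t (Ico_subset_Icc_self ht)) t ht
  refine h.trans ?_
  rw [gronwallBound_of_K_ne_0 one_ne_zero]
  have h1 : Real.exp (1 * (t - 0)) ≤ 3 := by
    rw [one_mul, sub_zero]
    refine (Real.exp_le_exp.2 ht.2).trans ?_
    have := Real.exp_one_lt_d9
    linarith
  simp only [zero_mul, div_one, zero_add]
  nlinarith

variable {B : Type*} [NormedAddCommGroup B] [NormedSpace ℝ B] {Ω : E → E →L[ℝ] B}
  {act : B →L[ℝ] F →L[ℝ] F}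

theorem norm_sub_le_of_mem_ball {E : Type*} [SeminormedAddCommGroup E] {c : E} {r : ℝ} {p x : E} (hp : p ∈ ball c r) (hx : x ∈ ball c r) :
    ‖x - p‖ ≤ 2 * r := by
  rw [← dist_eq_norm]
  have := dist_triangle_right x p c
  rw [mem_ball] at hp hx
  linarith

theorem norm_act_le {c : E} {r K : ℝ} (hK0 : 0 ≤ K)
    (hK : ∀ y ∈ ball c r, ‖Ω y‖ ≤ K) (hr : ‖act‖ * (K * (2 * r)) ≤ 1 / 2)
    {p x : E} (hp : p ∈ ball c r) (hx : x ∈ ball c r) {t : ℝ} (ht : t ∈ Icc (0 : ℝ) 1) :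
    ‖act (Ω (p + t • (x - p)) (x - p))‖ ≤ 1 / 2 :=
  calc _ ≤ ‖act‖ * ‖Ω (p + t • (x - p)) (x - p)‖ := ContinuousLinearMap.le_opNorm _ _
    _ ≤ ‖act‖ * (‖Ω (p + t • (x - p))‖ * ‖x - p‖) := by
      gcongr; exact ContinuousLinearMap.le_opNorm _ _
    _ ≤ ‖act‖ * (K * (2 * r)) := by
      gcongr
      · exact hK _ ((convex_ball c r).add_smul_sub_mem hp hx ht)
      · exact norm_sub_le_of_mem_ball hp hx
    _ ≤ _ := hr

/-- Parallel transport along a short segment. -/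
theorem exists_radial_solution [CompleteSpace F] {c : E} {r K : ℝ} (hK0 : 0 ≤ K)
    (hK : ∀ y ∈ ball c r, ‖Ω y‖ ≤ K) (hr : ‖act‖ * (K * (2 * r)) ≤ 1 / 2)
    (hc : ContinuousOn Ω (ball c r)) {p x : E} (hp : p ∈ ball c r) (hx : x ∈ ball c r) (b : F) :
    ∃ w : ℝ → F, w 0 = b ∧ ∀ t ∈ Icc (0 : ℝ) 1,
      HasDerivWithinAt w (act (Ω (p + t • (x - p)) (x - p)) (w t)) (Icc 0 1) t := by
  have hmem : ∀ t ∈ Icc (0 : ℝ) 1, p + t • (x - p) ∈ ball c r := fun t ht =>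
    (convex_ball c r).add_smul_sub_mem hp hx ht
  have hn := fun t (ht : t ∈ Icc (0 : ℝ) 1) => norm_act_le hK0 hK hr hp hx ht
  have hPL : IsPicardLindelof (fun t w => act (Ω (p + t • (x - p)) (x - p)) w)
      (⟨0, by simp⟩ : Icc (0 : ℝ) 1) b ‖b‖₊ 0 ‖b‖₊ 1 := by
    constructor
    · intro t ht
      refine LipschitzWith.lipschitzOnWith ?_
      refine (ContinuousLinearMap.lipschitz _).weaken ?_
      rw [← NNReal.coe_le_coe, coe_nnnorm]
      exact (hn t ht).trans (by norm_num)
    · intro w _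
      have h1 : ContinuousOn (fun t : ℝ => Ω (p + t • (x - p))) (Icc 0 1) :=
        hc.comp (by fun_prop) hmem
      exact (act.continuous.comp_continuousOn (h1.clm_apply continuousOn_const)).clm_apply
        continuousOn_const
    · intro t ht w hw
      have h1 : ‖w‖ ≤ 2 * ‖b‖ := by
        rw [mem_closedBall, dist_eq_norm, coe_nnnorm] at hw
        have := norm_le_norm_add_norm_sub' w b
        linarith
      calc _ ≤ ‖act (Ω (p + t • (x - p)) (x - p))‖ * ‖w‖ := ContinuousLinearMap.le_opNorm _ _
        _ ≤ 1 / 2 * (2 * ‖b‖) := by gcongr; exact hn t ht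
        _ = _ := by rw [coe_nnnorm]; ring
    · simp
  exact hPL.exists_eq_forall_mem_Icc_hasDerivWithinAt₀

theorem segment_point_sub (p x x' : E) (t : ℝ) :
    p + t • (x' - p) - (p + t • (x - p)) = t • (x' - x) := by
  rw [add_sub_add_left_eq_sub, ← smul_sub, sub_sub_sub_cancel_right]

theorem norm_smul_le_of_mem_Icc {t : ℝ} (ht : t ∈ Icc (0 : ℝ) 1) (x : E) : ‖t • x‖ ≤ ‖x‖ := by
  rw [norm_smul, Real.norm_eq_abs, abs_of_nonneg ht.1]
  exact mul_le_of_le_one_left (norm_nonneg _) ht.2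

theorem act_remainder_eq (β β' δ γ : B) (D₁ D₂ : B) (f f' : F) (t : ℝ)
    (hfl : act (D₁ - D₂) f = act β (act δ f) - act δ (act β f)) :
    act (γ + β') f' - act β f - (t • (act D₁ f + act δ (act β f)) + (1 : ℝ) • act δ f) =
      act β (f' - f - t • act δ f) +
        (act (γ + β' - β) (f' - f) + act ((γ - δ) + (β' - β - t • D₂)) f) := by
  have h : act D₁ f + act δ (act β f) = act D₂ f + act β (act δ f) := by
    rw [map_sub, sub_apply] at hfl
    rw [add_comm (act D₂ f), ← sub_eq_sub_iff_add_eq_add, hfl]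
  rw [h]
  simp only [map_sub, map_add, map_smul, sub_apply, add_apply, smul_apply, smul_add, one_smul]
  abel

theorem hasDerivWithinAt_radial (p x v : E) {t : ℝ} {s : Set ℝ}
    (hd : DifferentiableAt ℝ Ω (p + t • (x - p))) {w : ℝ → F} {w' : F}
    (hw : HasDerivWithinAt w w' s t) :
    HasDerivWithinAt (fun t : ℝ => t • act (Ω (p + t • (x - p)) v) (w t))
      (t • (act (fderiv ℝ Ω (p + t • (x - p)) (x - p) v) (w t) +
        act (Ω (p + t • (x - p)) v) w') +
          (1 : ℝ) • act (Ω (p + t • (x - p)) v) (w t)) s t := by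
  have hq : HasDerivWithinAt (fun t : ℝ => p + t • (x - p)) (x - p) s t := by
    simpa using ((hasDerivWithinAt_id t s).smul_const (x - p)).const_add p
  have h3 : HasDerivWithinAt (fun t : ℝ => Ω (p + t • (x - p)))
      (fderiv ℝ Ω (p + t • (x - p)) (x - p)) s t :=
    HasFDerivAt.comp_hasDerivWithinAt t hd.hasFDerivAt hq
  have h4 := h3.clm_apply (hasDerivWithinAt_const t s v)
  rw [map_zero, add_zero] at h4
  have h5 : HasDerivWithinAt (fun t : ℝ => act (Ω (p + t • (x - p)) v))
      (act (fderiv ℝ Ω (p + t • (x - p)) (x - p) v)) s t :=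
    act.hasFDerivAt.comp_hasDerivWithinAt t h4
  exact (hasDerivWithinAt_id t s).smul (h5.clm_apply hw)

/-- Radial parallel transport for a flat connection yields a parallel section. -/
theorem exists_parallel_section_of_bounds [CompleteSpace F] {c : E} {r K L₁ L₂ : ℝ}
    (hr0 : 0 < r) (hK0 : 0 ≤ K) (hL₁ : 0 ≤ L₁) (hL₂ : 0 ≤ L₂)
    (hK : ∀ y ∈ ball c r, ‖Ω y‖ ≤ K) (hr : ‖act‖ * (K * (2 * r)) ≤ 1 / 2)
    (hd : ∀ y ∈ ball c r, DifferentiableAt ℝ Ω y)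
    (h1 : ∀ y ∈ ball c r, ∀ z ∈ ball c r, ‖Ω z - Ω y‖ ≤ L₁ * ‖z - y‖)
    (h2 : ∀ y ∈ ball c r, ∀ z ∈ ball c r, ‖Ω z - Ω y - fderiv ℝ Ω y (z - y)‖ ≤ L₂ * ‖z - y‖ ^ 2)
    (flat : ∀ y ∈ ball c r, ∀ a v f, act (fderiv ℝ Ω y a v - fderiv ℝ Ω y v a) f =
      act (Ω y a) (act (Ω y v) f) - act (Ω y v) (act (Ω y a) f))
    {p : E} (hp : p ∈ ball c r) (b : F) :
    ∃ u : E → F, u p = b ∧ ∀ x ∈ ball c r, HasFDerivAt u ((act.flip (u x)).comp (Ω x)) x := by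
  have hcont : ContinuousOn Ω (ball c r) := fun y hy => (hd y hy).continuousAt.continuousWithinAt
  have hw : ∀ x, ∃ w : ℝ → F, x ∈ ball c r → w 0 = b ∧ ∀ t ∈ Icc (0 : ℝ) 1,
      HasDerivWithinAt w (act (Ω (p + t • (x - p)) (x - p)) (w t)) (Icc 0 1) t := by
    intro x
    by_cases hx : x ∈ ball c r
    · obtain ⟨w, hw⟩ := exists_radial_solution hK0 hK hr hcont hp hx b
      exact ⟨w, fun _ => hw⟩
    · exact ⟨fun _ => 0, fun h => absurd h hx⟩
  choose w hw using hw
  have hmem : ∀ x ∈ ball c r, ∀ t ∈ Icc (0 : ℝ) 1, p + t • (x - p) ∈ ball c r := fun x hx t ht =>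
    (convex_ball c r).add_smul_sub_mem hp hx ht
  have hxp : ∀ x ∈ ball c r, ‖x - p‖ ≤ 2 * r := fun x hx => norm_sub_le_of_mem_ball hp hx
  have hn : ∀ x ∈ ball c r, ∀ t ∈ Icc (0 : ℝ) 1, ∀ f,
      ‖act (Ω (p + t • (x - p)) (x - p)) f‖ ≤ ‖f‖ := fun x hx t ht f =>
    calc _ ≤ ‖act (Ω (p + t • (x - p)) (x - p))‖ * ‖f‖ := ContinuousLinearMap.le_opNorm _ _
      _ ≤ 1 * ‖f‖ := by
        gcongr
        exact (norm_act_le hK0 hK hr hp hx ht).trans (by norm_num)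
      _ = _ := one_mul _
  have hbd : ∀ x ∈ ball c r, ∀ t ∈ Icc (0 : ℝ) 1, ‖w x t‖ ≤ 3 * ‖b‖ := by
    intro x hx t ht
    have h := norm_le_of_norm_deriv_le (f := fun t => w x t - b) (norm_nonneg b)
      (by simp [(hw x hx).1]) (fun t ht => ((hw x hx).2 t ht).sub_const b)
      (fun t ht => (hn x hx t ht _).trans (by
        have := norm_le_norm_add_norm_sub' (w x t) b
        linarith)) t ht
    have := norm_le_norm_add_norm_sub' (w x t) b
    linarith
  set C : ℝ := K + L₁ * (2 * r) with hC
  have hC0 : 0 ≤ C := by positivity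
  have hA' : ∀ x ∈ ball c r, ∀ x' ∈ ball c r, ∀ t ∈ Icc (0 : ℝ) 1,
      ‖Ω (p + t • (x' - p)) (x' - p) - Ω (p + t • (x - p)) (x - p)‖ ≤ C * ‖x' - x‖ := by
    intro x hx x' hx' t ht
    have e : Ω (p + t • (x' - p)) (x' - p) - Ω (p + t • (x - p)) (x - p) =
        Ω (p + t • (x' - p)) (x' - x) + (Ω (p + t • (x' - p)) - Ω (p + t • (x - p))) (x - p) := by
      generalize Ω (p + t • (x' - p)) = β'
      generalize Ω (p + t • (x - p)) = β
      simp only [sub_apply, map_sub]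
      abel
    have h3 : ‖Ω (p + t • (x' - p)) - Ω (p + t • (x - p))‖ ≤ L₁ * ‖x' - x‖ := by
      refine (h1 _ (hmem x hx t ht) _ (hmem x' hx' t ht)).trans ?_
      rw [segment_point_sub]
      gcongr
      exact norm_smul_le_of_mem_Icc ht _
    calc _ ≤ ‖Ω (p + t • (x' - p)) (x' - x)‖ +
          ‖(Ω (p + t • (x' - p)) - Ω (p + t • (x - p))) (x - p)‖ := by rw [e]; exact norm_add_le _ _
      _ ≤ K * ‖x' - x‖ + L₁ * ‖x' - x‖ * (2 * r) := by
        gcongr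
        · exact (ContinuousLinearMap.le_opNorm _ _).trans (by gcongr; exact hK _ (hmem x' hx' t ht))
        · exact (ContinuousLinearMap.le_opNorm _ _).trans (by gcongr; exact hxp x hx)
      _ = _ := by rw [hC]; ring
  have hfirst : ∀ x ∈ ball c r, ∀ x' ∈ ball c r, ∀ t ∈ Icc (0 : ℝ) 1,
      ‖w x' t - w x t‖ ≤ 2 * (‖act‖ * (C * ‖x' - x‖) * (3 * ‖b‖)) := by
    intro x hx x' hx'
    refine norm_le_of_norm_deriv_le (f := fun t => w x' t - w x t) (by positivity)
      (by simp [(hw x hx).1, (hw x' hx').1])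
      (fun t ht => ((hw x' hx').2 t ht).sub ((hw x hx).2 t ht)) fun t ht => ?_
    have e : act (Ω (p + t • (x' - p)) (x' - p)) (w x' t) -
        act (Ω (p + t • (x - p)) (x - p)) (w x t) =
        act (Ω (p + t • (x - p)) (x - p)) (w x' t - w x t) +
        act (Ω (p + t • (x' - p)) (x' - p) - Ω (p + t • (x - p)) (x - p)) (w x' t) := by
      generalize Ω (p + t • (x' - p)) (x' - p) = β'
      generalize Ω (p + t • (x - p)) (x - p) = β
      simp only [sub_apply, map_sub]
      abel
    rw [e]
    refine (norm_add_le _ _).trans (add_le_add (hn x hx t ht _) ?_)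
    refine (ContinuousLinearMap.le_opNorm₂ _ _ _).trans ?_
    gcongr
    · exact hA' x hx x' hx' t ht
    · exact hbd x' hx' t ht
  set C₂ : ℝ := 2 * (‖act‖ * C * (2 * (‖act‖ * C * (3 * ‖b‖))) +
    ‖act‖ * (L₁ + L₂ * (2 * r)) * (3 * ‖b‖)) with hC₂
  have hsecond : ∀ x ∈ ball c r, ∀ x' ∈ ball c r,
      ‖w x' 1 - w x 1 - act (Ω x (x' - x)) (w x 1)‖ ≤ C₂ * ‖x' - x‖ ^ 2 := by
    intro x hx x' hx'
    have hder := fun t (ht : t ∈ Icc (0 : ℝ) 1) =>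
      (((hw x' hx').2 t ht).sub ((hw x hx).2 t ht)).sub
        (hasDerivWithinAt_radial (act := act) p x (x' - x) (hd _ (hmem x hx t ht))
          ((hw x hx).2 t ht))
    have h := norm_le_of_norm_deriv_le
      (ε := ‖act‖ * (C * ‖x' - x‖) * (2 * (‖act‖ * (C * ‖x' - x‖) * (3 * ‖b‖))) +
        ‖act‖ * (L₁ * ‖x' - x‖ * ‖x' - x‖ + L₂ * ‖x' - x‖ ^ 2 * (2 * r)) * (3 * ‖b‖))
      (by positivity) (by simp [(hw x hx).1, (hw x' hx').1]) hder (fun t ht => by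
        have hqm := hmem x hx t ht
        have hqm' := hmem x' hx' t ht
        have hfl := flat _ hqm (x - p) (x' - x) (w x t)
        have hqq := segment_point_sub p x x' t
        generalize hq : p + t • (x - p) = q at *
        generalize hq' : p + t • (x' - p) = q' at *
        have e := act_remainder_eq (Ω q (x - p)) (Ω q' (x - p)) (Ω q (x' - x)) (Ω q' (x' - x))
          _ _ (w x t) (w x' t) t hfl
        have e1 : Ω q' (x' - x) + Ω q' (x - p) = Ω q' (x' - p) := by
          rw [← map_add]; congr 1; abel
        rw [e1] at e
        simp only [Pi.sub_apply]
        rw [hq, e]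
        have hle : ‖q' - q‖ ≤ ‖x' - x‖ := by
          rw [hqq]
          exact norm_smul_le_of_mem_Icc ht _
        have hb := hA' x hx x' hx' t ht
        have hf := hfirst x hx x' hx' t ht
        rw [hq, hq'] at hb
        have hn' := hn x hx t ht
        rw [hq] at hn'
        refine (norm_add_le _ _).trans (add_le_add (hn' _) ?_)
        refine (norm_add_le _ _).trans (add_le_add ?_ ?_)
        · refine (ContinuousLinearMap.le_opNorm₂ _ _ _).trans ?_
          gcongr
        · refine (ContinuousLinearMap.le_opNorm₂ _ _ _).trans ?_
          gcongr
          · refine (norm_add_le _ _).trans (add_le_add ?_ ?_)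
            · rw [← sub_apply]
              refine (ContinuousLinearMap.le_opNorm _ _).trans ?_
              gcongr
              exact (h1 q hqm q' hqm').trans (by gcongr)
            · have e2 : Ω q' (x - p) - Ω q (x - p) - t • fderiv ℝ Ω q (x' - x) (x - p) =
                  (Ω q' - Ω q - fderiv ℝ Ω q (q' - q)) (x - p) := by
                rw [hqq, map_smul]
                simp only [sub_apply, smul_apply]
              rw [e2]
              refine (ContinuousLinearMap.le_opNorm _ _).trans ?_
              gcongr
              · exact (h2 q hqm q' hqm').trans (by gcongr)
              · exact hxp x hx
          · exact hbd x hx t ht) 1 (by simp)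
    simp only [Pi.sub_apply, one_smul, add_sub_cancel] at h
    refine h.trans (le_of_eq ?_)
    rw [hC₂]
    ring
  refine ⟨fun x => w x 1, ?_, fun x hx => ?_⟩
  · have h := norm_le_of_norm_deriv_le (f := fun t => w p t - b) le_rfl
      (by simp [(hw p hp).1]) (fun t ht => ((hw p hp).2 t ht).sub_const b)
      (fun t ht => by simp) 1 (by simp)
    rw [mul_zero] at h
    exact sub_eq_zero.1 (norm_le_zero_iff.1 h)
  · have hO : (fun x' => w x' 1 - w x 1 - act (Ω x (x' - x)) (w x 1)) =O[𝓝 x]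
        fun x' => ‖x' - x‖ ^ 2 := by
      refine Asymptotics.IsBigO.of_bound C₂ ?_
      filter_upwards [isOpen_ball.mem_nhds hx] with x' hx'
      rw [norm_pow, norm_norm]
      exact hsecond x hx x' hx'
    have h3 := hO.hasFDerivAt (𝕜 := ℝ) one_lt_two
    have h4 : HasFDerivAt (fun x' => ((act.flip (w x 1)).comp (Ω x)) (x' - x))
        ((act.flip (w x 1)).comp (Ω x)) x :=
      ((act.flip (w x 1)).comp (Ω x)).hasFDerivAt.comp x ((hasFDerivAt_id x).sub_const x)
    have h5 := (h3.add h4).add_const (w x 1)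
    rw [zero_add] at h5
    refine h5.congr_of_eventuallyEq (Eventually.of_forall fun x' => ?_)
    simp

/-- The first order Taylor formula for a function with Lipschitz derivative. -/
theorem norm_sub_sub_fderiv_le {f : E → F} {s : Set E} (hs : Convex ℝ s) {L : NNReal}
    (hd : ∀ x ∈ s, DifferentiableAt ℝ f x) (hl : LipschitzOnWith L (fderiv ℝ f) s) {y z : E}
    (hy : y ∈ s) (hz : z ∈ s) : ‖f z - f y - fderiv ℝ f y (z - y)‖ ≤ L * ‖z - y‖ ^ 2 := by
  have hseg : segment ℝ y z ⊆ s := hs.segment_subset hy hz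
  have h := (convex_segment (𝕜 := ℝ) y z).norm_image_sub_le_of_norm_fderiv_le' (f := f)
    (φ := fderiv ℝ f y) (C := L * ‖z - y‖) (fun x hx => hd x (hseg hx)) (fun x hx => by
      refine (hl.norm_sub_le (hseg hx) hy).trans ?_
      gcongr
      exact norm_sub_le_of_mem_segment hx)
    (left_mem_segment ℝ y z) (right_mem_segment ℝ y z)
  refine h.trans (le_of_eq ?_)
  ring

/-- Local existence of parallel sections of flat linear connections. -/
theorem exists_ball_parallel_sections [CompleteSpace F] {O : Set E} (hO : IsOpen O)
    (hΩ : ContDiffOn ℝ 2 Ω O)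
    (flat : ∀ y ∈ O, ∀ a v f, act (fderiv ℝ Ω y a v - fderiv ℝ Ω y v a) f =
      act (Ω y a) (act (Ω y v) f) - act (Ω y v) (act (Ω y a) f)) {c : E} (hc : c ∈ O) :
    ∃ r > 0, ball c r ⊆ O ∧ ∀ r' ≤ r, ∀ p ∈ ball c r', ∀ b, ∃ u : E → F, u p = b ∧
      ∀ x ∈ ball c r', HasFDerivAt u ((act.flip (u x)).comp (Ω x)) x := by
  have hΩc : ContDiffAt ℝ 2 Ω c := hΩ.contDiffAt (hO.mem_nhds hc)
  have hΩc1 : ContDiffAt ℝ 1 (fderiv ℝ Ω) c :=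
    hΩc.fderiv_right (m := 1) (le_of_eq one_add_one_eq_two)
  obtain ⟨L₁, s₁, hs₁, hl₁⟩ := (hΩc.of_le one_le_two).exists_lipschitzOnWith
  obtain ⟨L₂, s₂, hs₂, hl₂⟩ := hΩc1.exists_lipschitzOnWith
  set K := ‖Ω c‖ + 1 with hKdef
  have hKpos : 0 < K := by positivity
  have hb : ∀ᶠ y in 𝓝 c, ‖Ω y‖ < K :=
    hΩc.continuousAt.norm.eventually_lt continuousAt_const (by rw [hKdef]; linarith)
  obtain ⟨ε, hε, hball⟩ := Metric.mem_nhds_iff.1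
    (inter_mem (inter_mem (hO.mem_nhds hc) hb) (inter_mem hs₁ hs₂))
  have hpos : 0 < 4 * K * (‖act‖ + 1) := by positivity
  refine ⟨min ε (1 / (4 * K * (‖act‖ + 1))), by positivity, ?_, ?_⟩
  · intro y hy
    exact (hball (ball_subset_ball (min_le_left _ _) hy)).1.1
  · intro r' hr' p hp b
    have hsub : ball c r' ⊆ ball c ε := ball_subset_ball (hr'.trans (min_le_left _ _))
    have hr'pos : 0 < r' := pos_of_mem_ball hp
    have hd : ∀ y ∈ ball c r', DifferentiableAt ℝ Ω y := fun y hy =>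
      (hΩ.contDiffAt (hO.mem_nhds (hball (hsub hy)).1.1)).differentiableAt two_ne_zero
    refine exists_parallel_section_of_bounds (K := K) (L₁ := L₁) (L₂ := L₂) hr'pos
      hKpos.le L₁.2 L₂.2 ?_ ?_ hd ?_ ?_ ?_ hp b
    · intro y hy
      exact (hball (hsub hy)).1.2.le
    · calc ‖act‖ * (K * (2 * r')) ≤ (‖act‖ + 1) * (K * (2 * (1 / (4 * K * (‖act‖ + 1))))) := by
            gcongr
            · linarith
            · exact hr'.trans (min_le_right _ _)
        _ = 1 / 2 := by field_simp; norm_num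
    · intro y hy z hz
      have h3 := hl₁.dist_le_mul z (hball (hsub hz)).2.1 y (hball (hsub hy)).2.1
      rwa [dist_eq_norm, dist_eq_norm] at h3
    · intro y hy z hz
      exact norm_sub_sub_fderiv_le (convex_ball c r') hd
        (hl₂.mono fun x hx => (hball (hsub hx)).2.2) hy hz
    · intro y hy
      exact flat y (hball (hsub hy)).1.1

/-- Parallel sections on a convex set are determined by one value. -/
theorem eqOn_of_parallel {U : Set E} (hU : Convex ℝ U) (hΩ : ContinuousOn Ω U) {u v : E → F}
    (hu : ∀ x ∈ U, HasFDerivAt u ((act.flip (u x)).comp (Ω x)) x)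
    (hv : ∀ x ∈ U, HasFDerivAt v ((act.flip (v x)).comp (Ω x)) x) {p : E} (hp : p ∈ U)
    (h : u p = v p) : EqOn u v U := by
  intro x hx
  have hmem : ∀ t ∈ Icc (0 : ℝ) 1, p + t • (x - p) ∈ U := fun t ht =>
    hU.add_smul_sub_mem hp hx ht
  have hcont : ContinuousOn (fun t : ℝ => ‖act (Ω (p + t • (x - p)) (x - p))‖) (Icc 0 1) :=
    (act.continuous.comp_continuousOn
      ((hΩ.comp (by fun_prop) hmem).clm_apply continuousOn_const)).norm
  obtain ⟨K, hK⟩ := isCompact_Icc.bddAbove_image hcont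
  have hq : ∀ t : ℝ, HasDerivAt (fun t : ℝ => p + t • (x - p)) (x - p) t := fun t => by
    simpa using ((hasDerivAt_id t).smul_const (x - p)).const_add p
  have hder : ∀ t ∈ Icc (0 : ℝ) 1, HasDerivAt
      (fun t : ℝ => u (p + t • (x - p)) - v (p + t • (x - p)))
      (act (Ω (p + t • (x - p)) (x - p)) (u (p + t • (x - p)) - v (p + t • (x - p)))) t := by
    intro t ht
    have h1 := (hu _ (hmem t ht)).comp_hasDerivAt t (hq t)
    have h2 := (hv _ (hmem t ht)).comp_hasDerivAt t (hq t)
    rw [map_sub]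
    exact h1.sub h2
  have := eq_zero_of_abs_deriv_le_mul_abs_self_of_eq_zero_right (K := K) (a := 0) (b := 1)
    (fun t ht => (hder t ht).continuousAt.continuousWithinAt)
    (fun t ht => (hder t (Ico_subset_Icc_self ht)).hasDerivWithinAt) (by simp [h])
    (fun t ht => (ContinuousLinearMap.le_opNorm _ _).trans (by
      gcongr
      exact hK (mem_image_of_mem _ (Ico_subset_Icc_self ht)))) 1 (by simp)
  simpa [sub_eq_zero] using this

/-- Parallel sections of a smooth connection are smooth. -/
theorem contDiffOn_of_parallel {U : Set E} (hU : IsOpen U) (hΩ : ContDiffOn ℝ ∞ Ω U) {u : E → F}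
    (hu : ∀ x ∈ U, HasFDerivAt u ((act.flip (u x)).comp (Ω x)) x) : ContDiffOn ℝ ∞ u U := by
  rw [contDiffOn_infty]
  intro n
  induction n with
  | zero =>
    exact contDiffOn_zero.2 fun x hx => (hu x hx).continuousAt.continuousWithinAt
  | succ n ih =>
    have : ((n + 1 : ℕ) : WithTop ℕ∞) = (n : WithTop ℕ∞) + 1 := by push_cast; rfl
    rw [this, contDiffOn_succ_iff_fderiv_of_isOpen hU]
    refine ⟨fun x hx => (hu x hx).differentiableAt.differentiableWithinAt, by simp, ?_⟩
    have h1 : ContDiffOn ℝ n (fun x => (act.flip (u x)).comp (Ω x)) U :=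
      (act.flip.contDiff.comp_contDiffOn ih).clm_comp (contDiffOn_infty.1 hΩ n)
    exact h1.congr fun x hx => (hu x hx).fderiv

end FlatConnection

/-! ### Vector fields and one-forms in charts -/

section Charts

open VectorField Filter Topology

variable {E : Type*} [NormedAddCommGroup E] [NormedSpace ℝ E]
variable {M : Type*} [TopologicalSpace M] [ChartedSpace E M]

/-- The coordinate expression of a vector field in the preferred chart at a point. -/
noncomputable def chartField (x₀ : M) (V : ∀ x : M, TangentSpace 𝓘(ℝ, E) x) : E → E :=
  mpullback 𝓘(ℝ, E) 𝓘(ℝ, E) (extChartAt 𝓘(ℝ, E) x₀).symm V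

variable [IsManifold 𝓘(ℝ, E) ∞ M]

theorem contMDiffAt_extChartAt_symm_self {x₀ : M} {y : E}
    (hy : y ∈ (extChartAt 𝓘(ℝ, E) x₀).target) :
    ContMDiffAt 𝓘(ℝ, E) 𝓘(ℝ, E) ∞ (extChartAt 𝓘(ℝ, E) x₀).symm y :=
  (contMDiffOn_extChartAt_symm x₀).contMDiffAt ((isOpen_extChartAt_target x₀).mem_nhds hy)

theorem contMDiffAt_extChartAt_self {x₀ x : M}
    (hx : x ∈ (extChartAt 𝓘(ℝ, E) x₀).source) :
    ContMDiffAt 𝓘(ℝ, E) 𝓘(ℝ, E) ∞ (extChartAt 𝓘(ℝ, E) x₀) x :=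
  contMDiffAt_extChartAt' (by simpa using hx)

theorem isInvertible_mfderiv_extChartAt_symm {x₀ : M} {y : E}
    (hy : y ∈ (extChartAt 𝓘(ℝ, E) x₀).target) :
    (mfderiv 𝓘(ℝ, E) 𝓘(ℝ, E) (extChartAt 𝓘(ℝ, E) x₀).symm y).IsInvertible := by
  have : IsManifold 𝓘(ℝ, E) 1 M := .of_le (n := ∞) (by simp)
  have := isInvertible_mfderivWithin_extChartAt_symm (I := 𝓘(ℝ, E)) hy
  simpa using this

theorem mfderiv_chartField {x₀ : M} {y : E} (hy : y ∈ (extChartAt 𝓘(ℝ, E) x₀).target)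
    (V : ∀ x : M, TangentSpace 𝓘(ℝ, E) x) :
    mfderiv 𝓘(ℝ, E) 𝓘(ℝ, E) (extChartAt 𝓘(ℝ, E) x₀).symm y (chartField x₀ V y : E) =
      V ((extChartAt 𝓘(ℝ, E) x₀).symm y) := by
  exact (isInvertible_mfderiv_extChartAt_symm hy).self_apply_inverse _

variable [CompleteSpace E]

theorem contDiffOn_chartField (x₀ : M) (V : SmoothVectorField E M) :
    ContDiffOn ℝ ∞ (chartField x₀ V) (extChartAt 𝓘(ℝ, E) x₀).target := by
  intro y hy
  have h := ContMDiffAt.mpullback_vectorField_preimage (V := V) (n := ∞) (m := ∞)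
    V.contMDiff.contMDiffAt (contMDiffAt_extChartAt_symm_self hy)
    (isInvertible_mfderiv_extChartAt_symm hy) (by simp)
  exact ((contMDiffAt_vectorSpace_iff_contDiffAt (V := chartField x₀ V)).1 h).contDiffWithinAt

omit [CompleteSpace E] in
theorem mlieBracket_eq_lieBracket (V W : E → E) (y : E) :
    mlieBracket 𝓘(ℝ, E) (M := E) V W y = lieBracket ℝ V W y := by
  rw [← lieBracketWithin_univ]
  exact congrFun (mlieBracketWithin_eq_lieBracketWithin (V := V) (W := W) (s := univ)) y

theorem lieBracket_chartField {x₀ : M} {y : E} (hy : y ∈ (extChartAt 𝓘(ℝ, E) x₀).target)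
    (V W : SmoothVectorField E M) :
    lieBracket ℝ (chartField x₀ V) (chartField x₀ W) y = chartField x₀ (⁅V, W⁆ : SmoothVectorField E M) y := by
  have : IsManifold 𝓘(ℝ, E) (minSmoothness ℝ 3) M := by
    rw [minSmoothness_of_isRCLikeNormedField]; infer_instance
  have h := mpullback_mlieBracket (V := V) (W := W) (n := ∞) (V.mdifferentiableAt_mk _)
    (W.mdifferentiableAt_mk _)
    (contMDiffAt_extChartAt_symm_self hy) (by
      rw [minSmoothness_of_isRCLikeNormedField]
      exact WithTop.coe_le_coe.2 (le_top : (2 : ℕ∞) ≤ ⊤))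
  rw [← mlieBracket_eq_lieBracket]
  exact h.symm

end Charts

/-! ### One-forms in charts -/

section OneForms

open VectorField Filter Topology

variable {E : Type*} [NormedAddCommGroup E] [NormedSpace ℝ E]
variable {M : Type*} [TopologicalSpace M] [ChartedSpace E M]

/-- The coordinate expression of a one-form in the preferred chart at a point. -/
noncomputable def chartForm (x₀ : M) (η : ∀ x : M, TangentSpace 𝓘(ℝ, E) x →L[ℝ] ℝ) (y : E) :
    E →L[ℝ] ℝ :=
  (η ((extChartAt 𝓘(ℝ, E) x₀).symm y)).comp
    (mfderiv 𝓘(ℝ, E) 𝓘(ℝ, E) (extChartAt 𝓘(ℝ, E) x₀).symm y)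

variable [IsManifold 𝓘(ℝ, E) ∞ M]

theorem inCoordinates_oneForm (η : ∀ x : M, TangentSpace 𝓘(ℝ, E) x →L[ℝ] ℝ) {x₀ x : M}
    (hx : x ∈ (chartAt E x₀).source) :
    ContinuousLinearMap.inCoordinates E (TangentSpace 𝓘(ℝ, E)) ℝ (Trivial M ℝ) x₀ x x₀ x (η x) =
      chartForm x₀ η (extChartAt 𝓘(ℝ, E) x₀ x) := by
  have : IsManifold 𝓘(ℝ, E) 1 M := .of_le (n := ∞) (by simp)
  have hψ : (extChartAt 𝓘(ℝ, E) x₀).symm (extChartAt 𝓘(ℝ, E) x₀ x) = x :=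
    (extChartAt 𝓘(ℝ, E) x₀).left_inv (by simpa using hx)
  ext v
  rw [ContinuousLinearMap.inCoordinates, TangentBundle.symmL_trivializationAt hx]
  simp only [chartForm]
  have hη : ∀ z, z = x → ∀ w : E, (η z : E →L[ℝ] ℝ) w = (η x : E →L[ℝ] ℝ) w := by
    rintro _ rfl _; rfl
  simp only [Trivial.fiberBundle_trivializationAt', Trivial.continuousLinearMapAt_trivialization,
    ContinuousLinearMap.id_comp, modelWithCornersSelf_coe, range_id, mfderivWithin_univ]
  exact (hη _ hψ _).symm

theorem contMDiffAt_oneForm_iff (η : ∀ x : M, TangentSpace 𝓘(ℝ, E) x →L[ℝ] ℝ) (x₀ : M) :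
    ContMDiffAt 𝓘(ℝ, E) (𝓘(ℝ, E).prod 𝓘(ℝ, E →L[ℝ] ℝ)) ∞
      (fun x => TotalSpace.mk' (E →L[ℝ] ℝ)
        (E := fun x : M => TangentSpace 𝓘(ℝ, E) x →L[ℝ] ℝ) x (η x)) x₀ ↔
    ContDiffAt ℝ ∞ (chartForm x₀ η) (extChartAt 𝓘(ℝ, E) x₀ x₀) := by
  have h₁ : (fun x => ContinuousLinearMap.inCoordinates E (TangentSpace 𝓘(ℝ, E)) ℝ (Trivial M ℝ)
      x₀ x x₀ x (η x)) =ᶠ[𝓝 x₀] chartForm x₀ η ∘ extChartAt 𝓘(ℝ, E) x₀ := by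
    filter_upwards [chart_source_mem_nhds E x₀] with x hx using inCoordinates_oneForm η hx
  refine (contMDiffAt_hom_bundle _).trans ?_
  have h₂ : ContMDiffAt 𝓘(ℝ, E) 𝓘(ℝ, E →L[ℝ] ℝ) ∞ (chartForm x₀ η ∘ extChartAt 𝓘(ℝ, E) x₀) x₀ ↔
      ContDiffAt ℝ ∞ (chartForm x₀ η) (extChartAt 𝓘(ℝ, E) x₀ x₀) := by
    refine ⟨fun h => ?_, fun h => h.contMDiffAt.comp x₀
      (contMDiffAt_extChartAt_self (mem_extChartAt_source x₀))⟩
    have h₃ := ContMDiffAt.comp (extChartAt 𝓘(ℝ, E) x₀ x₀) (by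
        rwa [(extChartAt 𝓘(ℝ, E) x₀).left_inv (mem_extChartAt_source x₀)])
      (contMDiffAt_extChartAt_symm_self (mem_extChartAt_target x₀))
    refine (h₃.congr_of_eventuallyEq ?_).contDiffAt
    filter_upwards [(isOpen_extChartAt_target x₀).mem_nhds (mem_extChartAt_target x₀)] with y hy
    simp only [Function.comp_apply, (extChartAt 𝓘(ℝ, E) x₀).right_inv hy]
  rw [← h₂]
  exact ⟨fun h => h.2.congr_of_eventuallyEq h₁.symm,
    fun h => ⟨contMDiffAt_id, h.congr_of_eventuallyEq h₁⟩⟩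

theorem chartForm_chartField {x₀ : M} {y : E} (hy : y ∈ (extChartAt 𝓘(ℝ, E) x₀).target)
    (η : ∀ x : M, TangentSpace 𝓘(ℝ, E) x →L[ℝ] ℝ) (V : ∀ x : M, TangentSpace 𝓘(ℝ, E) x) :
    chartForm x₀ η y (chartField x₀ V y) =
      η ((extChartAt 𝓘(ℝ, E) x₀).symm y) (V ((extChartAt 𝓘(ℝ, E) x₀).symm y)) :=
  congrArg (η ((extChartAt 𝓘(ℝ, E) x₀).symm y)) (mfderiv_chartField hy V)

theorem SmoothOneForm.contDiffAt_chartForm (η : SmoothOneForm E M) (x : M) :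
    ContDiffAt ℝ ∞ (chartForm x η) (extChartAt 𝓘(ℝ, E) x x) :=
  (contMDiffAt_oneForm_iff η x).1 (η.contMDiff x)

theorem mfderiv_extChartAt_apply {x₀ x : M} (hx : x ∈ (extChartAt 𝓘(ℝ, E) x₀).source)
    (V : ∀ x : M, TangentSpace 𝓘(ℝ, E) x) :
    mfderiv 𝓘(ℝ, E) 𝓘(ℝ, E) (extChartAt 𝓘(ℝ, E) x₀) x (V x) =
      chartField x₀ V (extChartAt 𝓘(ℝ, E) x₀ x) := by
  have : IsManifold 𝓘(ℝ, E) 1 M := .of_le (n := ∞) (by simp)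
  have hy := (extChartAt 𝓘(ℝ, E) x₀).map_source hx
  have h := DFunLike.congr_fun (mfderiv_extChartAt_comp_mfderivWithin_extChartAt_symm
    (I := 𝓘(ℝ, E)) hy) (chartField x₀ V (extChartAt 𝓘(ℝ, E) x₀ x) : E)
  simp only [modelWithCornersSelf_coe, range_id, mfderivWithin_univ] at h
  have h' : mfderiv 𝓘(ℝ, E) 𝓘(ℝ, E) (extChartAt 𝓘(ℝ, E) x₀)
      ((extChartAt 𝓘(ℝ, E) x₀).symm (extChartAt 𝓘(ℝ, E) x₀ x))
      (V ((extChartAt 𝓘(ℝ, E) x₀).symm (extChartAt 𝓘(ℝ, E) x₀ x))) =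
      chartField x₀ V (extChartAt 𝓘(ℝ, E) x₀ x) :=
    (congrArg _ (mfderiv_chartField hy V).symm).trans h
  rwa [(extChartAt 𝓘(ℝ, E) x₀).left_inv hx] at h'

/-- The pairing of a smooth one-form with a smooth vector field is a smooth function. -/
theorem SmoothOneForm.contMDiff_apply (η : SmoothOneForm E M) (Y : SmoothVectorField E M) :
    ContMDiff 𝓘(ℝ, E) 𝓘(ℝ, ℝ) ∞ (fun x => η x (Y x)) := by
  have h := ContMDiff.clm_bundle_apply (F₁ := E) (E₁ := fun x : M => TangentSpace 𝓘(ℝ, E) x)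
    (F₂ := ℝ) (E₂ := Trivial M ℝ) η.contMDiff Y.contMDiff
  intro x
  exact (contMDiffAt_totalSpace.1 (h x)).2

theorem fderiv_comp_extChartAt_symm {g : M → ℝ} {x₀ : M} {y : E}
    (hy : y ∈ (extChartAt 𝓘(ℝ, E) x₀).target)
    (hg : MDifferentiableAt 𝓘(ℝ, E) 𝓘(ℝ, ℝ) g ((extChartAt 𝓘(ℝ, E) x₀).symm y))
    (V : ∀ x : M, TangentSpace 𝓘(ℝ, E) x) :
    fderiv ℝ (g ∘ (extChartAt 𝓘(ℝ, E) x₀).symm) y (chartField x₀ V y) =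
      differentialAt g ((extChartAt 𝓘(ℝ, E) x₀).symm y)
        (V ((extChartAt 𝓘(ℝ, E) x₀).symm y)) := by
  rw [← mfderiv_eq_fderiv, mfderiv_comp y hg
    ((contMDiffAt_extChartAt_symm_self hy).mdifferentiableAt (by simp))]
  exact congrArg _ (mfderiv_chartField hy V)

variable [CompleteSpace E]

theorem oneFormExtDeriv_apply (η : SmoothOneForm E M) (Y Z : SmoothVectorField E M) (x : M) :
    oneFormExtDeriv η x ![Y x, Z x] =
      differentialAt (fun x => η x (Z x)) x (Y x) - differentialAt (fun x => η x (Y x)) x (Z x) -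
        η x ((⁅Y, Z⁆ : SmoothVectorField E M) x) := by
  set c := extChartAt 𝓘(ℝ, E) x x
  have hc : c ∈ (extChartAt 𝓘(ℝ, E) x).target := mem_extChartAt_target x
  have hc' := (isOpen_extChartAt_target (I := 𝓘(ℝ, E)) x).mem_nhds hc
  have hψ : (extChartAt 𝓘(ℝ, E) x).symm c = x := extChartAt_to_inv x
  have hω : DifferentiableAt ℝ
      (fun y => ContinuousAlternatingMap.ofSubsingleton ℝ E ℝ (0 : Fin 1) (chartForm x η y)) c :=
    (ContinuousAlternatingMap.ofSubsingletonLIE (𝕜 := ℝ) (E := E) (F := ℝ)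
      (0 : Fin 1)).differentiableAt.comp c
      ((η.contDiffAt_chartForm x).differentiableAt (by simp))
  have hV (V : SmoothVectorField E M) : DifferentiableAt ℝ (chartField x V) c :=
    ((contDiffOn_chartField x V).contDiffAt hc').differentiableAt (by simp)
  have key := extDeriv_apply_vectorField (V := ![chartField x Y, chartField x Z]) hω (by
    intro i
    fin_cases i
    exacts [hV Y, hV Z])
  have hd (V W : SmoothVectorField E M) :
      fderiv ℝ (fun y => chartForm x η y (chartField x V y)) c (chartField x W c) =
        differentialAt (fun x => η x (V x)) x (W x) := by
    have h : (fun y => chartForm x η y (chartField x V y)) =ᶠ[𝓝 c]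
        (fun x => η x (V x)) ∘ (extChartAt 𝓘(ℝ, E) x).symm := by
      filter_upwards [hc'] with y hy using chartForm_chartField hy η V
    rw [h.fderiv_eq, fderiv_comp_extChartAt_symm hc
      ((η.contMDiff_apply V).mdifferentiableAt (by simp)), hψ]
  have hL : chartForm x η c (lieBracket ℝ (chartField x Y) (chartField x Z) c) =
      η x ((⁅Y, Z⁆ : SmoothVectorField E M) x) := by
    rw [lieBracket_chartField hc, chartForm_chartField hc, hψ]
  have h₀ : oneFormExtDeriv η x ![Y x, Z x] = extDeriv (fun y =>
      ContinuousAlternatingMap.ofSubsingleton ℝ E ℝ (0 : Fin 1) (chartForm x η y)) c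
      (fun i => (![chartField x Y, chartField x Z] : Fin 2 → E → E) i c) := by
    have : (fun i => (![chartField x Y, chartField x Z] : Fin 2 → E → E) i c) = fun i =>
        mfderiv 𝓘(ℝ, E) 𝓘(ℝ, E) (extChartAt 𝓘(ℝ, E) x) x
          ((![Y x, Z x] : Fin 2 → TangentSpace 𝓘(ℝ, E) x) i) := by
      funext i
      fin_cases i
      exacts [(mfderiv_extChartAt_apply (mem_extChartAt_source x) Y).symm,
        (mfderiv_extChartAt_apply (mem_extChartAt_source x) Z).symm]
    rw [this]
    rfl
  rw [h₀, key, ← hd, ← hd, ← hL]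
  simp only [Fin.sum_univ_succ, Nat.reduceAdd, Finset.univ_eq_empty, Finset.sum_empty]
  simp
  exact (sub_eq_add_neg _ _).symm

end OneForms

/-! ### The flat connection of a frame spanning a Lie algebra -/

section FrameConnection

open Filter Topology

variable {E : Type*} [NormedAddCommGroup E] [NormedSpace ℝ E] [CompleteSpace E]
  {T : E → E →L[ℝ] E} {O : Set E}

theorem contDiffOn_inverse_frame (hO : IsOpen O) (hT : ContDiffOn ℝ ∞ T O)
    (hinv : ∀ y ∈ O, (T y).IsInvertible) : ContDiffOn ℝ ∞ (fun y => (T y).inverse) O := by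
  intro y hy
  obtain ⟨e, he⟩ := hinv y hy
  have h : ContDiffAt ℝ ∞ ContinuousLinearMap.inverse (T y) := he ▸ contDiffAt_map_inverse e
  exact (h.comp y (hT.contDiffAt (hO.mem_nhds hy))).contDiffWithinAt

theorem fderiv_inverse_frame (hO : IsOpen O) (hT : ContDiffOn ℝ ∞ T O)
    (hinv : ∀ y ∈ O, (T y).IsInvertible) {y : E} (hy : y ∈ O) (a b : E) :
    fderiv ℝ (fun y => (T y).inverse) y a (T y b) = - (T y).inverse (fderiv ℝ T y a b) := by
  have h₁ := (((contDiffOn_inverse_frame hO hT hinv).contDiffAt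
    (hO.mem_nhds hy)).differentiableAt (by simp)).hasFDerivAt
  have h₂ := ((hT.contDiffAt (hO.mem_nhds hy)).differentiableAt (by simp)).hasFDerivAt
  have h₃ : (fun y => (T y).inverse (T y b)) =ᶠ[𝓝 y] fun _ => b := by
    filter_upwards [hO.mem_nhds hy] with z hz using (hinv z hz).inverse_apply_self b
  have h₄ := (h₁.clm_apply (h₂.clm_apply (hasFDerivAt_const b y))).unique
    ((hasFDerivAt_const b y).congr_of_eventuallyEq h₃)
  have h₅ := DFunLike.congr_fun h₄ a
  simp at h₅
  exact eq_neg_of_add_eq_zero_right h₅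

theorem flat_inverse_frame (br : E →L[ℝ] E →L[ℝ] E)
    (jacobi : ∀ a b f, br a (br b f) - br b (br a f) = br (br a b) f)
    (hO : IsOpen O) (hT : ContDiffOn ℝ ∞ T O) (hinv : ∀ y ∈ O, (T y).IsInvertible)
    (hbr : ∀ y ∈ O, ∀ a b, fderiv ℝ T y (T y a) b - fderiv ℝ T y (T y b) a = T y (br a b))
    (y : E) (hy : y ∈ O) (a v f : E) :
    (-br) (fderiv ℝ (fun y => (T y).inverse) y a v - fderiv ℝ (fun y => (T y).inverse) y v a) f =
      (-br) ((T y).inverse a) ((-br) ((T y).inverse v) f) -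
        (-br) ((T y).inverse v) ((-br) ((T y).inverse a) f) := by
  obtain ⟨α, rfl⟩ := (hinv y hy).surjective a
  obtain ⟨β, rfl⟩ := (hinv y hy).surjective v
  rw [fderiv_inverse_frame hO hT hinv hy, fderiv_inverse_frame hO hT hinv hy, neg_sub_neg,
    ← map_sub, ← neg_sub, hbr y hy, map_neg, (hinv y hy).inverse_apply_self,
    (hinv y hy).inverse_apply_self, (hinv y hy).inverse_apply_self]
  simp [← jacobi]

end FrameConnection

section LieFrame

open VectorField Filter Topology

variable {E : Type*} [NormedAddCommGroup E] [NormedSpace ℝ E] [CompleteSpace E]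
variable {M : Type*} [TopologicalSpace M] [ChartedSpace E M] [IsManifold 𝓘(ℝ, E) ∞ M]
variable {𝔤 : Type*} [LieRing 𝔤] [LieAlgebra ℝ 𝔤]

/-- The homomorphism `ρ` from a Lie algebra to vector fields is a frame: its evaluations at all
points are linear isomorphisms. -/
structure IsLieFrame (ρ : 𝔤 →ₗ[ℝ] SmoothVectorField E M) : Prop where
  map_lie : ∀ ξ ζ, ρ ⁅ξ, ζ⁆ = ⁅ρ ξ, ρ ζ⁆
  bijective : ∀ x, Function.Bijective fun ξ => ρ ξ x

/-- The vector field `x ↦ ρ (l x) x` commutes at `x` with all vector fields `ρ ξ`. -/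
def CommutesAt (ρ : 𝔤 →ₗ[ℝ] SmoothVectorField E M) (l : M → 𝔤) (x : M) : Prop :=
  ∀ c : Module.Dual ℝ 𝔤, MDifferentiableAt 𝓘(ℝ, E) 𝓘(ℝ, ℝ) (fun y => c (l y)) x ∧
    ∀ ξ, differentialAt (fun y => c (l y)) x (ρ ξ x) = - c ⁅ξ, l x⁆

omit [CompleteSpace E] in
theorem CommutesAt.congr {ρ : 𝔤 →ₗ[ℝ] SmoothVectorField E M} {l l' : M → 𝔤} {x : M}
    (h : CommutesAt ρ l x) (hl : l =ᶠ[𝓝 x] l') : CommutesAt ρ l' x := by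
  intro c
  have hc : (fun y => c (l y)) =ᶠ[𝓝 x] fun y => c (l' y) := hl.fun_comp c
  refine ⟨(h c).1.congr_of_eventuallyEq hc.symm, fun ξ => ?_⟩
  rw [differentialAt, ← hc.mfderiv_eq, ← hl.self_of_nhds]
  exact (h c).2 ξ

namespace IsLieFrame

variable {ρ : 𝔤 →ₗ[ℝ] SmoothVectorField E M} (hρ : IsLieFrame ρ)

/-- Evaluation of a frame at a point. -/
noncomputable def evalEquiv (x : M) : 𝔤 ≃ₗ[ℝ] E :=
  LinearEquiv.ofBijective
    { toFun := fun ξ => ρ ξ x, map_add' := fun ξ ζ => by rw [map_add]; rfl,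
      map_smul' := fun c ξ => by rw [map_smul]; rfl } (hρ.bijective x)

variable [FiniteDimensional ℝ E]

/-- A frame in the preferred chart at `x₀`, parametrized by the model space. -/
noncomputable def chartFrame (x₀ : M) (y : E) : E →L[ℝ] E :=
  LinearMap.toContinuousLinearMap
    { toFun := fun a => chartField x₀ (ρ ((hρ.evalEquiv x₀).symm a)) y
      map_add' := fun a b => by
        rw [map_add, map_add]
        exact map_add (mfderiv 𝓘(ℝ, E) 𝓘(ℝ, E) (extChartAt 𝓘(ℝ, E) x₀).symm y).inverse _ _
      map_smul' := fun c a => by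
        rw [map_smul, map_smul]
        exact map_smul (mfderiv 𝓘(ℝ, E) 𝓘(ℝ, E) (extChartAt 𝓘(ℝ, E) x₀).symm y).inverse _ _ }

/-- The Lie bracket of `𝔤` transported to the model space. -/
noncomputable def modelBracket (x₀ : M) :
    E →L[ℝ] E →L[ℝ] E :=
  LinearMap.toContinuousBilinearMap <|
    LinearMap.mk₂ ℝ (fun a b => hρ.evalEquiv x₀ ⁅(hρ.evalEquiv x₀).symm a,
      (hρ.evalEquiv x₀).symm b⁆) (by simp) (by simp) (by simp) (by simp)

theorem chartFrame_apply (x₀ : M) (y a : E) :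
    hρ.chartFrame x₀ y a = chartField x₀ (ρ ((hρ.evalEquiv x₀).symm a)) y := rfl

theorem modelBracket_apply (x₀ : M) (a b : E) :
    hρ.modelBracket x₀ a b = hρ.evalEquiv x₀ ⁅(hρ.evalEquiv x₀).symm a,
      (hρ.evalEquiv x₀).symm b⁆ := rfl

theorem modelBracket_jacobi (x₀ : M) (a b f : E) :
    hρ.modelBracket x₀ a (hρ.modelBracket x₀ b f) - hρ.modelBracket x₀ b (hρ.modelBracket x₀ a f) =
      hρ.modelBracket x₀ (hρ.modelBracket x₀ a b) f := by
  simp only [modelBracket_apply, LinearEquiv.symm_apply_apply, ← map_sub, ← lie_lie]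

theorem contDiffOn_chartFrame (x₀ : M) :
    ContDiffOn ℝ ∞ (hρ.chartFrame x₀) (extChartAt 𝓘(ℝ, E) x₀).target :=
  contDiffOn_clm_apply.2 fun a => contDiffOn_chartField x₀ (ρ ((hρ.evalEquiv x₀).symm a))

theorem isInvertible_chartFrame {x₀ : M} {y : E} (hy : y ∈ (extChartAt 𝓘(ℝ, E) x₀).target) :
    (hρ.chartFrame x₀ y).IsInvertible := by
  have hinj : Function.Injective (hρ.chartFrame x₀ y) := by
    intro a b hab
    rw [chartFrame_apply, chartFrame_apply] at hab
    have h := (mfderiv_chartField hy (ρ ((hρ.evalEquiv x₀).symm a))).symm.trans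
      ((congrArg _ hab).trans (mfderiv_chartField hy (ρ ((hρ.evalEquiv x₀).symm b))))
    exact (hρ.evalEquiv x₀).symm.injective ((hρ.bijective _).injective h)
  exact ⟨(LinearEquiv.ofInjectiveEndo (hρ.chartFrame x₀ y).toLinearMap hinj).toContinuousLinearEquiv,
    rfl⟩

theorem fderiv_chartFrame {x₀ : M} {y : E} (hy : y ∈ (extChartAt 𝓘(ℝ, E) x₀).target) (a b : E) :
    fderiv ℝ (hρ.chartFrame x₀) y (hρ.chartFrame x₀ y a) b -
      fderiv ℝ (hρ.chartFrame x₀) y (hρ.chartFrame x₀ y b) a =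
        hρ.chartFrame x₀ y (hρ.modelBracket x₀ a b) := by
  have hd := ((hρ.contDiffOn_chartFrame x₀).contDiffAt
    ((isOpen_extChartAt_target x₀).mem_nhds hy)).differentiableAt (by simp)
  have h (a v : E) : fderiv ℝ (hρ.chartFrame x₀) y v a =
      fderiv ℝ (chartField x₀ (ρ ((hρ.evalEquiv x₀).symm a))) y v := by
    have := (hd.hasFDerivAt.clm_apply (hasFDerivAt_const a y)).fderiv
    have h' := DFunLike.congr_fun this v
    simp at h'
    exact h'.symm
  rw [h, h, chartFrame_apply, chartFrame_apply, chartFrame_apply, modelBracket_apply,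
    LinearEquiv.symm_apply_apply, hρ.map_lie, ← lieBracket_chartField hy]
  rfl

end IsLieFrame

end LieFrame

/-! ### Local frames commuting with a Lie frame -/

section CommutingSections

open VectorField Filter Topology Metric

section

variable {E : Type*} [NormedAddCommGroup E] [NormedSpace ℝ E]
variable {M : Type*} [TopologicalSpace M] [ChartedSpace E M] [IsManifold 𝓘(ℝ, E) ∞ M]

theorem mdifferentiableAt_of_comp_extChartAt_symm {g : M → ℝ} {x₀ : M} {y : E}
    (hy : y ∈ (extChartAt 𝓘(ℝ, E) x₀).target)
    (hg : DifferentiableAt ℝ (g ∘ (extChartAt 𝓘(ℝ, E) x₀).symm) y) :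
    MDifferentiableAt 𝓘(ℝ, E) 𝓘(ℝ, ℝ) g ((extChartAt 𝓘(ℝ, E) x₀).symm y) := by
  have hx := (extChartAt 𝓘(ℝ, E) x₀).map_target hy
  have h : MDifferentiableAt 𝓘(ℝ, E) 𝓘(ℝ, ℝ)
      ((g ∘ (extChartAt 𝓘(ℝ, E) x₀).symm) ∘ extChartAt 𝓘(ℝ, E) x₀)
      ((extChartAt 𝓘(ℝ, E) x₀).symm y) := by
    refine MDifferentiableAt.comp _ ?_ ((contMDiffAt_extChartAt_self hx).mdifferentiableAt (by simp))
    rw [(extChartAt 𝓘(ℝ, E) x₀).right_inv hy]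
    exact hg.mdifferentiableAt
  refine h.congr_of_eventuallyEq ?_
  filter_upwards [(isOpen_extChartAt_source x₀).mem_nhds hx] with z hz
  simp only [Function.comp_apply, (extChartAt 𝓘(ℝ, E) x₀).left_inv hz]

end

section

variable {E F : Type*} [NormedAddCommGroup E] [NormedSpace ℝ E] [NormedAddCommGroup F]
  [NormedSpace ℝ F] [FiniteDimensional ℝ F]

/-- Differentiability of a map to a finite-dimensional space, tested on linear forms. -/
theorem hasFDerivAt_of_dual {u : E → F} {L : E →L[ℝ] F} {y : E}
    (hu : ∀ c : Module.Dual ℝ F, DifferentiableAt ℝ (fun z => c (u z)) y)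
    (hL : ∀ (c : Module.Dual ℝ F) v, fderiv ℝ (fun z => c (u z)) y v = c (L v)) :
    HasFDerivAt u L y := by
  let b := Module.finBasis ℝ F
  have hu' : DifferentiableAt ℝ u y := by
    rw [← b.equivFunL.comp_differentiableAt_iff, differentiableAt_pi]
    exact fun i => hu (b.coord i)
  convert hu'.hasFDerivAt
  ext v
  refine b.ext_elem fun i => ?_
  have h := (((b.coord i).toContinuousLinearMap.hasFDerivAt).comp y hu'.hasFDerivAt).fderiv
  exact (hL (b.coord i) v).symm.trans (DFunLike.congr_fun h v)

end

variable {E : Type*} [NormedAddCommGroup E] [NormedSpace ℝ E] [FiniteDimensional ℝ E]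
  [CompleteSpace E]
variable {M : Type*} [TopologicalSpace M] [ChartedSpace E M] [IsManifold 𝓘(ℝ, E) ∞ M]
variable {𝔤 : Type*} [LieRing 𝔤] [LieAlgebra ℝ 𝔤]

namespace IsLieFrame

variable {ρ : 𝔤 →ₗ[ℝ] SmoothVectorField E M} (hρ : IsLieFrame ρ)

theorem commutesAt_iff {x₀ : M} {y : E} (hy : y ∈ (extChartAt 𝓘(ℝ, E) x₀).target) (l : M → 𝔤) :
    CommutesAt ρ l ((extChartAt 𝓘(ℝ, E) x₀).symm y) ↔
      HasFDerivAt (fun z => hρ.evalEquiv x₀ (l ((extChartAt 𝓘(ℝ, E) x₀).symm z)))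
        (((-hρ.modelBracket x₀).flip (hρ.evalEquiv x₀ (l ((extChartAt 𝓘(ℝ, E) x₀).symm y)))).comp
          (hρ.chartFrame x₀ y).inverse) y := by
  have hinv := hρ.isInvertible_chartFrame hy
  constructor
  · intro h
    refine hasFDerivAt_of_dual (fun c => ?_) fun c v => ?_
    · have h₁ := (h (c ∘ₗ (hρ.evalEquiv x₀).toLinearMap)).1
      exact (h₁.comp y ((contMDiffAt_extChartAt_symm_self hy).mdifferentiableAt
        (by simp))).differentiableAt
    · obtain ⟨a, rfl⟩ := hinv.surjective v
      have h₁ := h (c ∘ₗ (hρ.evalEquiv x₀).toLinearMap)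
      have h₂ := fderiv_comp_extChartAt_symm hy h₁.1 (ρ ((hρ.evalEquiv x₀).symm a))
      rw [h₁.2] at h₂
      refine h₂.trans ?_
      simp [hinv.inverse_apply_self, modelBracket_apply]
  · intro h c
    have hc := ((c ∘ₗ (hρ.evalEquiv x₀).symm.toLinearMap).toContinuousLinearMap.hasFDerivAt).comp
      y h
    have hc' : (fun y => c (l y)) ∘ (extChartAt 𝓘(ℝ, E) x₀).symm =
        ((c ∘ₗ (hρ.evalEquiv x₀).symm.toLinearMap).toContinuousLinearMap) ∘
        (fun z => hρ.evalEquiv x₀ (l ((extChartAt 𝓘(ℝ, E) x₀).symm z))) := by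
      funext z
      simp
    have h₁ : MDifferentiableAt 𝓘(ℝ, E) 𝓘(ℝ, ℝ) (fun y => c (l y))
        ((extChartAt 𝓘(ℝ, E) x₀).symm y) := by
      refine mdifferentiableAt_of_comp_extChartAt_symm hy ?_
      rw [hc']
      exact hc.differentiableAt
    refine ⟨h₁, fun ξ => ?_⟩
    rw [← fderiv_comp_extChartAt_symm hy h₁, hc', hc.fderiv]
    have : chartField x₀ (ρ ξ) y = hρ.chartFrame x₀ y (hρ.evalEquiv x₀ ξ) := by
      rw [chartFrame_apply, LinearEquiv.symm_apply_apply]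
    rw [this]
    rw [← lie_skew, map_neg, neg_neg]
    simp [hinv.inverse_apply_self, modelBracket_apply]

include hρ in
theorem isLocalSystem : IsLocalSystem (CommutesAt ρ) where
  congr u v x huv hu := hu.congr huv
  trivialized x₀ N hN := by
    have hO := isOpen_extChartAt_target (I := 𝓘(ℝ, E)) x₀
    have hT := hρ.contDiffOn_chartFrame x₀
    have hinv : ∀ y ∈ (extChartAt 𝓘(ℝ, E) x₀).target, (hρ.chartFrame x₀ y).IsInvertible :=
      fun y hy => hρ.isInvertible_chartFrame hy
    have hΩ := contDiffOn_inverse_frame hO hT hinv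
    obtain ⟨r, hr, hrO, h⟩ := exists_ball_parallel_sections (act := -hρ.modelBracket x₀) hO
      (hΩ.of_le (WithTop.coe_le_coe.2 (le_top : (2 : ℕ∞) ≤ ⊤)))
      (flat_inverse_frame (hρ.modelBracket x₀) (hρ.modelBracket_jacobi x₀) hO hT hinv
        fun y hy => hρ.fderiv_chartFrame hy) (mem_extChartAt_target x₀)
    have hN' : (extChartAt 𝓘(ℝ, E) x₀).symm ⁻¹' N ∈ 𝓝 (extChartAt 𝓘(ℝ, E) x₀ x₀) := by
      refine (continuousAt_extChartAt_symm x₀).preimage_mem_nhds ?_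
      rwa [extChartAt_to_inv]
    obtain ⟨ε, hε, hεN⟩ := Metric.mem_nhds_iff.1 hN'
    set c := extChartAt 𝓘(ℝ, E) x₀ x₀
    have hBr : ball c (min r ε) ⊆ ball c r := ball_subset_ball (min_le_left _ _)
    have hBO := hBr.trans hrO
    refine ⟨(extChartAt 𝓘(ℝ, E) x₀).source ∩ extChartAt 𝓘(ℝ, E) x₀ ⁻¹' ball c (min r ε),
      ?_, ⟨mem_extChartAt_source x₀, mem_ball_self (lt_min hr hε)⟩, ?_, ?_, ?_, ?_⟩
    · rintro z ⟨hz, hz'⟩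
      have := hεN (ball_subset_ball (min_le_right _ _) hz')
      rwa [mem_preimage, (extChartAt 𝓘(ℝ, E) x₀).left_inv hz] at this
    · exact (continuousOn_extChartAt x₀).isOpen_inter_preimage (isOpen_extChartAt_source x₀)
        isOpen_ball
    · have : (extChartAt 𝓘(ℝ, E) x₀).source ∩ extChartAt 𝓘(ℝ, E) x₀ ⁻¹' ball c (min r ε) =
          (extChartAt 𝓘(ℝ, E) x₀).symm '' ball c (min r ε) := by
        rw [← (extChartAt 𝓘(ℝ, E) x₀).symm_image_target_inter_eq', inter_eq_self_of_subset_right hBO]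
      rw [this]
      exact (convex_ball c _).isPreconnected.image _ ((continuousOn_extChartAt_symm x₀).mono hBO)
    · rintro z ⟨hz, hz'⟩ a
      obtain ⟨u, hu, hu'⟩ := h _ (min_le_left _ _) _ hz' (hρ.evalEquiv x₀ a)
      refine ⟨fun w => (hρ.evalEquiv x₀).symm (u (extChartAt 𝓘(ℝ, E) x₀ w)), by
        simp only [hu, LinearEquiv.symm_apply_apply], ?_⟩
      rintro w ⟨hw, hw'⟩
      rw [← (extChartAt 𝓘(ℝ, E) x₀).left_inv hw, hρ.commutesAt_iff (hBO hw')]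
      have := hu' _ hw'
      simp only [LinearEquiv.apply_symm_apply, (extChartAt 𝓘(ℝ, E) x₀).right_inv (hBO hw')]
      refine this.congr_of_eventuallyEq ?_
      filter_upwards [hO.mem_nhds (hBO hw')] with q hq
      rw [(extChartAt 𝓘(ℝ, E) x₀).right_inv hq]
    · rintro u v hu hv z ⟨hz, hz'⟩ huv w ⟨hw, hw'⟩
      have key : ∀ q ∈ ball c (min r ε), (extChartAt 𝓘(ℝ, E) x₀).symm q ∈
          (extChartAt 𝓘(ℝ, E) x₀).source ∩ extChartAt 𝓘(ℝ, E) x₀ ⁻¹' ball c (min r ε) :=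
        fun q hq => ⟨(extChartAt 𝓘(ℝ, E) x₀).map_target (hBO hq), by
          rwa [mem_preimage, (extChartAt 𝓘(ℝ, E) x₀).right_inv (hBO hq)]⟩
      have := eqOn_of_parallel (convex_ball c (min r ε)) (hΩ.continuousOn.mono hBO)
        (fun q hq => (hρ.commutesAt_iff (hBO hq) u).1 (hu _ (key q hq)))
        (fun q hq => (hρ.commutesAt_iff (hBO hq) v).1 (hv _ (key q hq))) hz'
        (by simp only [(extChartAt 𝓘(ℝ, E) x₀).left_inv hz, huv]) hw'
      simp only [(extChartAt 𝓘(ℝ, E) x₀).left_inv hw] at this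
      exact (hρ.evalEquiv x₀).injective this

/-- Sections commuting with a Lie frame are smooth. -/
theorem contDiffOn_of_commutesAt {l : M → 𝔤} (hl : ∀ x, CommutesAt ρ l x) (x₀ : M) :
    ContDiffOn ℝ ∞ (fun z => hρ.evalEquiv x₀ (l ((extChartAt 𝓘(ℝ, E) x₀).symm z)))
      (extChartAt 𝓘(ℝ, E) x₀).target := by
  have hO := isOpen_extChartAt_target (I := 𝓘(ℝ, E)) x₀
  have hΩ := contDiffOn_inverse_frame hO (hρ.contDiffOn_chartFrame x₀)
    fun y hy => hρ.isInvertible_chartFrame hy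
  exact contDiffOn_of_parallel hO hΩ fun y hy => (hρ.commutesAt_iff hy l).1 (hl _)

end IsLieFrame

end CommutingSections

/-! ### Reeb vectors in linear algebra -/

section ReebVector

variable {F : Type*} [AddCommGroup F] [Module ℝ F]

namespace AlternatingMap

theorem apply_add_left (w : F [⋀^Fin 2]→ₗ[ℝ] ℝ) (x x' y : F) :
    w ![x + x', y] = w ![x, y] + w ![x', y] := by
  have h := w.map_update_add ![x, y] 0 x x'
  have e (z : F) : Function.update ![x, y] 0 z = ![z, y] := by
    ext i
    fin_cases i <;> rfl
  rwa [e, e, e] at h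

theorem apply_smul_left (w : F [⋀^Fin 2]→ₗ[ℝ] ℝ) (c : ℝ) (x y : F) :
    w ![c • x, y] = c * w ![x, y] := by
  have h := w.map_update_smul ![x, y] 0 c x
  have e (z : F) : Function.update ![x, y] 0 z = ![z, y] := by
    ext i
    fin_cases i <;> rfl
  rwa [e, e] at h

theorem apply_pair_swap (w : F [⋀^Fin 2]→ₗ[ℝ] ℝ) (x y : F) : w ![x, y] = - w ![y, x] := by
  have h := w.map_swap ![y, x] (i := 0) (j := 1) (by simp)
  rw [← h]
  congr 1
  ext i
  fin_cases i <;> rfl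

/-- A 2-form as a bilinear form. -/
noncomputable def toBilin (w : F [⋀^Fin 2]→ₗ[ℝ] ℝ) : F →ₗ[ℝ] F →ₗ[ℝ] ℝ :=
  LinearMap.mk₂ ℝ (fun x y => w ![x, y]) w.apply_add_left w.apply_smul_left
    (fun x y y' => by
      rw [w.apply_pair_swap, w.apply_add_left, neg_add, ← w.apply_pair_swap, ← w.apply_pair_swap])
    (fun c x y => by
      rw [w.apply_pair_swap, w.apply_smul_left, w.apply_pair_swap y, mul_neg, neg_neg, smul_eq_mul])

theorem toBilin_apply (w : F [⋀^Fin 2]→ₗ[ℝ] ℝ) (x y : F) : w.toBilin x y = w ![x, y] := rfl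

/-- A 2-form on an odd-dimensional space is degenerate. -/
theorem exists_ne_zero_forall_apply_pair_eq_zero [FiniteDimensional ℝ F]
    (w : F [⋀^Fin 2]→ₗ[ℝ] ℝ) (hF : Odd (Module.finrank ℝ F)) :
    ∃ r ≠ 0, ∀ v, w ![r, v] = 0 := by
  let b := Module.finBasis ℝ F
  let A : Matrix (Fin (Module.finrank ℝ F)) (Fin (Module.finrank ℝ F)) ℝ :=
    Matrix.of fun i j => w ![b j, b i]
  have hA : A.transpose = -A := by
    ext i j
    exact w.apply_pair_swap _ _
  have hdet : A.det = 0 := by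
    have h := congrArg Matrix.det hA
    rw [Matrix.det_transpose, Matrix.det_neg, Fintype.card_fin, hF.neg_one_pow] at h
    linarith
  obtain ⟨v, hv, hv'⟩ := Matrix.exists_mulVec_eq_zero_iff.2 hdet
  refine ⟨b.equivFun.symm v, by rwa [Ne, LinearEquiv.map_eq_zero_iff], fun x => ?_⟩
  have : w.toBilin (b.equivFun.symm v) = 0 := by
    refine b.ext fun i => ?_
    have h := congrFun hv' i
    rw [Module.Basis.equivFun_symm_apply, map_sum]
    simp only [LinearMap.sum_apply, map_smul, LinearMap.smul_apply, toBilin_apply, smul_eq_mul,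
      LinearMap.zero_apply]
    refine Eq.trans ?_ h
    exact Finset.sum_congr rfl fun j _ => mul_comm _ _
  exact DFunLike.congr_fun this x

end AlternatingMap

/-- In dimension `2 k + 1`, if `θ ∧ w ^ k ≠ 0` then there is a Reeb vector. -/
theorem exists_reeb_of_contactTopForm_ne_zero [FiniteDimensional ℝ F] {k : ℕ}
    (hF : Module.finrank ℝ F = 2 * k + 1) {θ : F →ₗ[ℝ] ℝ} {w : F [⋀^Fin 2]→ₗ[ℝ] ℝ}
    (h : contactTopForm k θ w ≠ 0) : ∃ r, θ r = 1 ∧ ∀ v, w ![r, v] = 0 := by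
  obtain ⟨r, hr, hr'⟩ := w.exists_ne_zero_forall_apply_pair_eq_zero (hF ▸ odd_two_mul_add_one k)
  by_cases hθ : θ r = 0
  · exfalso
    obtain ⟨μ, hμ⟩ := Module.Projective.exists_dual_eq_one ℝ hr
    let p : F →ₗ[ℝ] F := LinearMap.id - μ.smulRight r
    have hp (v : F) : p v = v - μ v • r := rfl
    have hpr : p r = 0 := by simp [hp, hμ]
    have h₁ : θ ∘ₗ p = θ := by
      ext v
      simp [hp, hθ]
    have h₂ : w.compLinearMap p = w := by
      have h₃ (x y : F) : w ![p x, p y] = w ![x, y] := by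
        have h₄ (v z : F) : w.toBilin (p v) z = w.toBilin v z := by
          simp [hp, w.toBilin_apply r, hr']
        rw [← w.toBilin_apply, h₄, w.toBilin_apply, w.apply_pair_swap, ← w.toBilin_apply, h₄,
          w.toBilin_apply, ← w.apply_pair_swap]
      ext v
      have := h₃ (v 0) (v 1)
      simp only [AlternatingMap.compLinearMap_apply]
      convert this using 2 <;>
      · ext i
        fin_cases i <;> rfl
    apply h
    have h₅ := contactTopForm_compLinearMap k θ w p
    rw [h₁, h₂] at h₅
    rw [← h₅]
    ext v
    change contactTopForm k θ w (fun i => p (v i)) = 0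
    refine AlternatingMap.map_linearDependent _ _ fun hv => hr ?_
    have hspan := hv.span_eq_top_of_card_eq_finrank (by rw [Fintype.card_fin, hF, add_comm])
    have hsurj : Function.Surjective p := by
      rw [← LinearMap.range_eq_top, eq_top_iff, ← hspan, Submodule.span_le]
      rintro _ ⟨i, rfl⟩
      exact ⟨v i, rfl⟩
    exact LinearMap.injective_iff_surjective.2 hsurj (hpr.trans p.map_zero.symm)
  · refine ⟨(θ r)⁻¹ • r, by simp [hθ], fun v => ?_⟩
    rw [w.apply_smul_left, hr', mul_zero]

end ReebVector

/-! ### Contact forms adapted to a Lie frame -/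

section AdaptedContactForms

open VectorField Filter Topology Metric

section

variable {E : Type*} [NormedAddCommGroup E] [NormedSpace ℝ E]
variable {M : Type*} [TopologicalSpace M] [ChartedSpace E M] [IsManifold 𝓘(ℝ, E) ∞ M]

/-- A function with vanishing differential is locally constant. -/
theorem eventually_eq_of_differentialAt_eq_zero {f : M → ℝ} {x : M}
    (hf : ∀ᶠ y in 𝓝 x, MDifferentiableAt 𝓘(ℝ, E) 𝓘(ℝ, ℝ) f y ∧ differentialAt (E := E) f y = 0) :
    ∀ᶠ y in 𝓝 x, f y = f x := by
  have h₁ : ∀ᶠ z in 𝓝 (extChartAt 𝓘(ℝ, E) x x),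
      (MDifferentiableAt 𝓘(ℝ, E) 𝓘(ℝ, ℝ) f ((extChartAt 𝓘(ℝ, E) x).symm z) ∧
        differentialAt (E := E) f ((extChartAt 𝓘(ℝ, E) x).symm z) = 0) ∧
      z ∈ (extChartAt 𝓘(ℝ, E) x).target := by
    refine Eventually.and ?_ ((isOpen_extChartAt_target x).mem_nhds (mem_extChartAt_target x))
    refine Tendsto.eventually (p := fun y => MDifferentiableAt 𝓘(ℝ, E) 𝓘(ℝ, ℝ) f y ∧
      differentialAt (E := E) f y = 0) (continuousAt_extChartAt_symm (I := 𝓘(ℝ, E)) x) ?_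
    rwa [extChartAt_to_inv]
  obtain ⟨ε, hε, hb⟩ := Metric.mem_nhds_iff.1 h₁
  have h₂ : ∀ z ∈ ball (extChartAt 𝓘(ℝ, E) x x) ε,
      HasFDerivWithinAt (f ∘ (extChartAt 𝓘(ℝ, E) x).symm) (0 : E →L[ℝ] ℝ)
        (ball (extChartAt 𝓘(ℝ, E) x x) ε) z := by
    intro z hz
    obtain ⟨⟨h₃, h₄⟩, h₅⟩ := hb hz
    have h₆ := h₃.hasMFDerivAt.comp z
      ((contMDiffAt_extChartAt_symm_self h₅).mdifferentiableAt (by simp)).hasMFDerivAt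
    have h₇ := h₆.hasFDerivAt
    have h₈ : mfderiv 𝓘(ℝ, E) 𝓘(ℝ, ℝ) f ((extChartAt 𝓘(ℝ, E) x).symm z) = 0 := h₄
    rw [h₈] at h₇
    exact (h₇.congr_fderiv (ContinuousLinearMap.zero_comp _)).hasFDerivWithinAt
  have h₉ : extChartAt 𝓘(ℝ, E) x ⁻¹' ball (extChartAt 𝓘(ℝ, E) x x) ε ∈ 𝓝 x :=
    (continuousAt_extChartAt x).preimage_mem_nhds (ball_mem_nhds _ hε)
  filter_upwards [h₉, extChartAt_source_mem_nhds (I := 𝓘(ℝ, E)) x] with y hy hy'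
  have := (convex_ball (extChartAt 𝓘(ℝ, E) x x) ε).is_const_of_fderivWithin_eq_zero (𝕜 := ℝ)
    (fun z hz => (h₂ z hz).differentiableWithinAt) (fun z hz => (h₂ z hz).fderivWithin
      (isOpen_ball.uniqueDiffWithinAt hz)) hy (mem_ball_self hε)
  simpa only [Function.comp_apply, (extChartAt 𝓘(ℝ, E) x).left_inv hy', extChartAt_to_inv] using this

/-- A function with vanishing differential on a connected open set is constant there. -/
theorem eq_of_differentialAt_eq_zero {f : M → ℝ} {U : Set M} (hU : IsOpen U)
    (hU' : IsPreconnected U)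
    (hf : ∀ y ∈ U, MDifferentiableAt 𝓘(ℝ, E) 𝓘(ℝ, ℝ) f y ∧ differentialAt (E := E) f y = 0)
    {x y : M} (hx : x ∈ U) (hy : y ∈ U) : f y = f x := by
  have := Subtype.preconnectedSpace hU'
  refine forall_of_locally_propagating (X := U) (P := fun z => f z = f x) (x₀ := ⟨x, hx⟩)
    (fun z => ?_) rfl ⟨y, hy⟩
  have h := eventually_eq_of_differentialAt_eq_zero (E := E) (f := f) (x := z)
    (Filter.eventually_of_mem (hU.mem_nhds z.2) hf)
  exact ⟨_, continuousAt_subtype_val.eventually h, fun a ha b hb hab => by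
    rw [show f b = f z from hb, ← show f a = f z from ha, hab]⟩

end

variable {E : Type*} [NormedAddCommGroup E] [NormedSpace ℝ E] [CompleteSpace E]
variable {M : Type*} [TopologicalSpace M] [ChartedSpace E M] [IsManifold 𝓘(ℝ, E) ∞ M]
variable {𝔤 : Type*} [LieRing 𝔤] [LieAlgebra ℝ 𝔤]

/-- Along a contact Hamiltonian vector field, a contact form is rescaled. -/
theorem IsContactHamiltonian.exists_differentialAt_apply {η : SmoothOneForm E M}
    {Y : SmoothVectorField E M} {h : M → ℝ} (hY : IsContactHamiltonian η Y h) (x : M) :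
    ∃ r, IsReebVector η x r ∧ ∀ Z : SmoothVectorField E M,
      differentialAt (fun y => η y (Z y)) x (Y x) =
        η x ((⁅Y, Z⁆ : SmoothVectorField E M) x) - differentialAt h x r * η x (Z x) := by
  have hh : h = fun y => - η y (Y y) := by
    funext y
    obtain ⟨r, -, hr, -⟩ := hY.2 y
    rw [hr, neg_neg]
  have hd (v : TangentSpace 𝓘(ℝ, E) x) :
      differentialAt h x v = - differentialAt (fun y => η y (Y y)) x v := by
    have h₁ := ((η.contMDiff_apply Y).mdifferentiableAt (x := x) (by simp)).hasMFDerivAt.neg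
    rw [hh]
    exact DFunLike.congr_fun h₁.mfderiv v
  obtain ⟨r, hr, -, hr'⟩ := hY.2 x
  refine ⟨r, hr, fun Z => ?_⟩
  have h₁ := hr' (Z x)
  rw [oneFormExtDeriv_apply, hd (Z x)] at h₁
  linarith

namespace IsLieFrame

variable {ρ : 𝔤 →ₗ[ℝ] SmoothVectorField E M} (hρ : IsLieFrame ρ)

theorem evalCovector_eq (η : SmoothOneForm E M) (x : M) :
    evalCovector ρ x η = (η x).toLinearMap ∘ₗ (hρ.evalEquiv x).toLinearMap := rfl

include hρ

/-- Contact forms with Hamiltonian frame fields are represented by contact covectors. -/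
theorem evalCovector_mem_contactCovectors [FiniteDimensional ℝ 𝔤] {k : ℕ} {η : SmoothOneForm E M}
    (hη : η ∈ hamiltonianContactForms k (range ρ)) (x : M) :
    evalCovector ρ x η ∈ contactCovectors 𝔤 k := by
  rw [hρ.evalCovector_eq]
  refine (contactTopForm_ne_zero_iff k (hρ.evalEquiv x) fun ξ ζ hξ hζ => ?_).1 (hη.1 x)
  obtain ⟨h, hh⟩ := hη.2 (ρ ξ) ⟨ξ, rfl⟩
  obtain ⟨h', hh'⟩ := hη.2 (ρ ζ) ⟨ζ, rfl⟩
  obtain ⟨r, -, hr⟩ := hh.exists_differentialAt_apply x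
  obtain ⟨r', -, hr'⟩ := hh'.exists_differentialAt_apply x
  have h₁ := hr (ρ ζ)
  have h₂ := hr' (ρ ξ)
  have hξ' : η x (ρ ξ x) = 0 := hξ
  have hζ' : η x (ρ ζ x) = 0 := hζ
  have h₃ : (⁅ρ ζ, ρ ξ⁆ : SmoothVectorField E M) x = - (⁅ρ ξ, ρ ζ⁆ : SmoothVectorField E M) x := by
    rw [← lie_skew]; rfl
  rw [hζ', mul_zero, sub_zero] at h₁
  rw [hξ', mul_zero, sub_zero, h₃, map_neg] at h₂
  have h₄ := oneFormExtDeriv_apply η (ρ ξ) (ρ ζ) x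
  rw [h₁, h₂, ← hρ.map_lie] at h₄
  refine h₄.trans ?_
  rw [sub_neg_eq_add, add_sub_cancel_right]
  rfl

theorem mem_conservativeContactForms_iff [FiniteDimensional ℝ E] [FiniteDimensional ℝ 𝔤] {k : ℕ}
    (hk : Module.finrank ℝ E = 2 * k + 1) (η : SmoothOneForm E M) :
    η ∈ conservativeContactForms k (range ρ) ↔
      (∀ x, evalCovector ρ x η ∈ contactCovectors 𝔤 k) ∧ ∀ x ξ ζ,
        differentialAt (fun y => η y (ρ ζ y)) x (ρ ξ x) = η x (ρ ⁅ξ, ζ⁆ x) := by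
  constructor
  · intro hη
    refine ⟨hρ.evalCovector_mem_contactCovectors ⟨hη.1, fun Y hY => (hη.2 Y hY).imp fun h => And.left⟩,
      fun x ξ ζ => ?_⟩
    obtain ⟨h, hh, hh'⟩ := hη.2 (ρ ξ) ⟨ξ, rfl⟩
    obtain ⟨r, hr, hr'⟩ := hh.exists_differentialAt_apply x
    rw [hr', hh' x r hr, zero_mul, sub_zero, hρ.map_lie]
  · rintro ⟨hΘ, hη⟩
    have hd (x : M) (ξ ζ : 𝔤) : oneFormExtDeriv η x ![ρ ξ x, ρ ζ x] = η x (ρ ⁅ξ, ζ⁆ x) := by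
      rw [oneFormExtDeriv_apply, hη, hη, ← hρ.map_lie, ← lie_skew, map_neg]
      simp
    have hc : IsContactForm k η := fun x =>
      (contactTopForm_ne_zero_iff k (hρ.evalEquiv x) fun ξ ζ _ _ => hd x ξ ζ).2 (hΘ x)
    refine ⟨hc, ?_⟩
    rintro _ ⟨ξ, rfl⟩
    have hneg (x : M) (ζ : 𝔤) : differentialAt (fun y => - η y (ρ ξ y)) x (ρ ζ x) =
        η x (ρ ⁅ξ, ζ⁆ x) := by
      have h₁ := ((η.contMDiff_apply (ρ ξ)).mdifferentiableAt (x := x) (by simp)).hasMFDerivAt.neg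
      refine (DFunLike.congr_fun h₁.mfderiv (ρ ζ x)).trans ?_
      refine (congrArg Neg.neg (hη x ζ ξ)).trans ?_
      rw [← lie_skew, map_neg]
      simp
    have hR : IsReebFirstIntegral η (fun y => - η y (ρ ξ y)) := by
      intro x r hr
      obtain ⟨ζ, rfl⟩ := (hρ.bijective x).surjective r
      have h₁ := hr.2 (ρ ξ x)
      simp only at h₁ ⊢
      rw [hd] at h₁
      rw [hneg, ← lie_skew, map_neg]
      simp [h₁]
    refine ⟨_, ⟨(η.contMDiff_apply (ρ ξ)).neg, fun x => ?_⟩, hR⟩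
    obtain ⟨r, hr⟩ := exists_reeb_of_contactTopForm_ne_zero hk (hc x)
    have hr' : IsReebVector η x r := hr
    refine ⟨r, hr', by simp, fun v => ?_⟩
    obtain ⟨ζ, rfl⟩ := (hρ.bijective x).surjective v
    rw [hR x r hr', zero_mul, sub_zero]
    exact (hd x ξ ζ).trans (hneg x ζ).symm

theorem commutesAt_lie [FiniteDimensional ℝ E] {l l' : M → 𝔤} {x : M} (hl : CommutesAt ρ l x)
    (hl' : CommutesAt ρ l' x) : CommutesAt ρ (fun y => ⁅l y, l' y⁆) x := by
  have hy := mem_extChartAt_target (I := 𝓘(ℝ, E)) x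
  rw [← extChartAt_to_inv (I := 𝓘(ℝ, E)) x, hρ.commutesAt_iff hy] at hl hl' ⊢
  have e (ξ ζ : 𝔤) : hρ.evalEquiv x ⁅ξ, ζ⁆ =
      hρ.modelBracket x (hρ.evalEquiv x ξ) (hρ.evalEquiv x ζ) := by simp [modelBracket_apply]
  simp only [e]
  refine (((hρ.modelBracket x).hasFDerivAt.comp _ hl).clm_apply hl').congr_fderiv ?_
  ext v
  have h := hρ.modelBracket_jacobi x
    ((hρ.chartFrame x (extChartAt 𝓘(ℝ, E) x x)).inverse v)
    (hρ.evalEquiv x (l ((extChartAt 𝓘(ℝ, E) x).symm (extChartAt 𝓘(ℝ, E) x x))))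
    (hρ.evalEquiv x (l' ((extChartAt 𝓘(ℝ, E) x).symm (extChartAt 𝓘(ℝ, E) x x))))
  simp only [add_apply, ContinuousLinearMap.comp_apply, ContinuousLinearMap.flip_apply,
    neg_apply, map_neg, Function.comp_apply]
  rw [← h]
  abel

theorem commutesAt_add [FiniteDimensional ℝ E] {l l' : M → 𝔤} {x : M} (hl : CommutesAt ρ l x)
    (hl' : CommutesAt ρ l' x) : CommutesAt ρ (fun y => l y + l' y) x := by
  have hy := mem_extChartAt_target (I := 𝓘(ℝ, E)) x
  rw [← extChartAt_to_inv (I := 𝓘(ℝ, E)) x, hρ.commutesAt_iff hy] at hl hl' ⊢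
  simpa using hl.fun_add hl'

theorem commutesAt_smul [FiniteDimensional ℝ E] {l : M → 𝔤} {x : M} (c : ℝ)
    (hl : CommutesAt ρ l x) : CommutesAt ρ (fun y => c • l y) x := by
  have hy := mem_extChartAt_target (I := 𝓘(ℝ, E)) x
  rw [← extChartAt_to_inv (I := 𝓘(ℝ, E)) x, hρ.commutesAt_iff hy] at hl ⊢
  simpa using hl.fun_const_smul c

end IsLieFrame

end AdaptedContactForms

/-! ### Conservative contact forms and contact covectors -/

section ConservativeContactForms

open VectorField Filter Topology Metric

variable {E : Type*} [NormedAddCommGroup E] [NormedSpace ℝ E] [FiniteDimensional ℝ E]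
  [CompleteSpace E]
variable {M : Type*} [TopologicalSpace M] [ChartedSpace E M] [IsManifold 𝓘(ℝ, E) ∞ M]
variable {𝔤 : Type*} [LieRing 𝔤] [LieAlgebra ℝ 𝔤]

namespace IsLieFrame

variable {ρ : 𝔤 →ₗ[ℝ] SmoothVectorField E M} (hρ : IsLieFrame ρ)
include hρ

/-- The derivative of the pairing of a one-form with a section commuting with the frame. -/
theorem differentialAt_pairing (η : SmoothOneForm E M) {l : M → 𝔤} {x : M}
    (hl : CommutesAt ρ l x) :
    MDifferentiableAt 𝓘(ℝ, E) 𝓘(ℝ, ℝ) (fun y => η y (ρ (l y) y)) x ∧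
    ∀ ξ, differentialAt (fun y => η y (ρ (l y) y)) x (ρ ξ x) =
      differentialAt (fun y => η y (ρ (l x) y)) x (ρ ξ x) - η x (ρ ⁅ξ, l x⁆ x) := by
  set c := extChartAt 𝓘(ℝ, E) x x
  have hc : c ∈ (extChartAt 𝓘(ℝ, E) x).target := mem_extChartAt_target x
  have hc' := (isOpen_extChartAt_target (I := 𝓘(ℝ, E)) x).mem_nhds hc
  have hψ : (extChartAt 𝓘(ℝ, E) x).symm c = x := extChartAt_to_inv x
  have hinv := hρ.isInvertible_chartFrame hc
  have hG₀ : DifferentiableAt ℝ (fun z => (chartForm x η z).comp (hρ.chartFrame x z)) c :=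
    ((η.contDiffAt_chartForm x).differentiableAt (by simp)).clm_comp
      (((hρ.contDiffOn_chartFrame x).contDiffAt hc').differentiableAt (by simp))
  set G : E → E →L[ℝ] ℝ := fun z => (chartForm x η z).comp (hρ.chartFrame x z) with hG
  have hGa (z : E) (hz : z ∈ (extChartAt 𝓘(ℝ, E) x).target) (ξ : 𝔤) : G z (hρ.evalEquiv x ξ) =
      η ((extChartAt 𝓘(ℝ, E) x).symm z) (ρ ξ ((extChartAt 𝓘(ℝ, E) x).symm z)) := by
    rw [hG, ← chartForm_chartField hz, ContinuousLinearMap.comp_apply, chartFrame_apply,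
      LinearEquiv.symm_apply_apply]
  have hd (ξ ζ : 𝔤) : fderiv ℝ G c (chartField x (ρ ξ) c) (hρ.evalEquiv x ζ) =
      differentialAt (fun y => η y (ρ ζ y)) x (ρ ξ x) := by
    have h₁ := fderiv_comp_extChartAt_symm hc
      ((η.contMDiff_apply (ρ ζ)).mdifferentiableAt (by simp)) (ρ ξ)
    have h₂ : (fun y => η y (ρ ζ y)) ∘ (extChartAt 𝓘(ℝ, E) x).symm =ᶠ[𝓝 c]
        fun z => G z (hρ.evalEquiv x ζ) := by
      filter_upwards [hc'] with z hz using (hGa z hz ζ).symm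
    rw [hψ, h₂.fderiv_eq, (hG₀.hasFDerivAt.clm_apply (hasFDerivAt_const _ c)).fderiv] at h₁
    simpa using h₁
  have hu := (hρ.commutesAt_iff hc l).1 (by rwa [hψ])
  have hf : (fun y => η y (ρ (l y) y)) ∘ (extChartAt 𝓘(ℝ, E) x).symm =ᶠ[𝓝 c]
      fun z => G z (hρ.evalEquiv x (l ((extChartAt 𝓘(ℝ, E) x).symm z))) := by
    filter_upwards [hc'] with z hz using (hGa z hz _).symm
  have hf' := (hG₀.hasFDerivAt.clm_apply hu).congr_of_eventuallyEq hf
  have hm : MDifferentiableAt 𝓘(ℝ, E) 𝓘(ℝ, ℝ) (fun y => η y (ρ (l y) y))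
      ((extChartAt 𝓘(ℝ, E) x).symm c) :=
    mdifferentiableAt_of_comp_extChartAt_symm hc hf'.differentiableAt
  refine ⟨by rwa [hψ] at hm, fun ξ => ?_⟩
  have h₁ := fderiv_comp_extChartAt_symm hc hm (ρ ξ)
  have hT : chartField x (ρ ξ) c = hρ.chartFrame x c (hρ.evalEquiv x ξ) := by
    rw [chartFrame_apply, LinearEquiv.symm_apply_apply]
  have hb : (-hρ.modelBracket x).flip (hρ.evalEquiv x (l x))
      ((hρ.chartFrame x c).inverse (chartField x (ρ ξ) c)) = - hρ.evalEquiv x ⁅ξ, l x⁆ := by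
    rw [hT, hinv.inverse_apply_self, ContinuousLinearMap.flip_apply, neg_apply, neg_apply,
      modelBracket_apply, LinearEquiv.symm_apply_apply, LinearEquiv.symm_apply_apply]
  rw [hf'.fderiv, hψ] at h₁
  replace h₁ : G c ((-hρ.modelBracket x).flip (hρ.evalEquiv x (l x))
      ((hρ.chartFrame x c).inverse (chartField x (ρ ξ) c))) +
      fderiv ℝ G c (chartField x (ρ ξ) c) (hρ.evalEquiv x (l x)) =
      differentialAt (fun y => η y (ρ (l y) y)) x (ρ ξ x) := h₁
  rw [hb, map_neg, hGa c hc, hψ, hd] at h₁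
  rw [← h₁]
  ring

/-- The pairing of an invariant one-form with a section commuting with the frame is constant. -/
theorem pairing_eq {η : SmoothOneForm E M}
    (hη : ∀ x ξ ζ, differentialAt (fun y => η y (ρ ζ y)) x (ρ ξ x) = η x (ρ ⁅ξ, ζ⁆ x))
    {U : Set M} (hU : IsOpen U) (hU' : IsPreconnected U) {l : M → 𝔤}
    (hl : ∀ y ∈ U, CommutesAt ρ l y) {x y : M} (hx : x ∈ U) (hy : y ∈ U) :
    η y (ρ (l y) y) = η x (ρ (l x) x) := by
  refine eq_of_differentialAt_eq_zero (E := E) (f := fun y => η y (ρ (l y) y)) hU hU'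
    (fun z hz => ?_) hx hy
  obtain ⟨h, h'⟩ := hρ.differentialAt_pairing η (hl z hz)
  refine ⟨h, ContinuousLinearMap.ext fun v => ?_⟩
  obtain ⟨ξ, rfl⟩ := (hρ.bijective z).surjective v
  exact (h' ξ).trans (by rw [hη, sub_self]; rfl)

theorem injOn_evalCovector [FiniteDimensional ℝ 𝔤] [PreconnectedSpace M] {k : ℕ}
    (hk : Module.finrank ℝ E = 2 * k + 1) (x : M) :
    InjOn (evalCovector ρ x) (conservativeContactForms k (range ρ)) := by
  intro η hη η' hη' h
  have h₁ := ((hρ.mem_conservativeContactForms_iff hk η).1 hη).2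
  have h₂ := ((hρ.mem_conservativeContactForms_iff hk η').1 hη').2
  have key : ∀ y, evalCovector ρ y η = evalCovector ρ y η' := by
    refine forall_of_locally_propagating
      (P := fun y => evalCovector ρ y η = evalCovector ρ y η') (fun z => ?_) h
    obtain ⟨U, -, hz, hU⟩ := hρ.isLocalSystem.trivialized z univ univ_mem
    refine ⟨U, hU.isOpen.mem_nhds hz, fun a ha b hb hab => LinearMap.ext fun ζ => ?_⟩
    obtain ⟨l, rfl, hl⟩ := hU.exists_section b hb ζ
    have h₃ := hρ.pairing_eq h₁ hU.isOpen hU.isPreconnected hl ha hb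
    have h₄ := hρ.pairing_eq h₂ hU.isOpen hU.isPreconnected hl ha hb
    exact h₃.trans ((DFunLike.congr_fun hab (l a)).trans h₄.symm)
  ext y v
  obtain ⟨ξ, rfl⟩ := (hρ.bijective y).surjective v
  exact DFunLike.congr_fun (key y) ξ

/-- If the frame fields commute with a global frame, all contact covectors are represented by
contact forms. -/
theorem exists_mem_conservativeContactForms [FiniteDimensional ℝ 𝔤] [PreconnectedSpace M] {k : ℕ}
    (hk : Module.finrank ℝ E = 2 * k + 1) {x : M}
    (hglob : ∀ ξ, ∃ l : M → 𝔤, l x = ξ ∧ ∀ y, CommutesAt ρ l y)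
    {ϑ : Module.Dual ℝ 𝔤} (hϑ : ϑ ∈ contactCovectors 𝔤 k) :
    ∃ η ∈ conservativeContactForms k (range ρ), evalCovector ρ x η = ϑ := by
  choose l hlx hl using hglob
  have huniq {u v : M → 𝔤} (hu : ∀ y, CommutesAt ρ u y) (hv : ∀ y, CommutesAt ρ v y)
      (h : u x = v x) (y : M) : u y = v y := congrFun (hρ.isLocalSystem.eq_of_eq_at hu hv h) y
  let Λ₀ (y : M) : 𝔤 →ₗ[ℝ] 𝔤 :=
    { toFun := fun ξ => l ξ y
      map_add' := fun ξ ζ => huniq (hl _) (fun z => hρ.commutesAt_add (hl ξ z) (hl ζ z))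
        (by simp [hlx]) y
      map_smul' := fun c ξ => huniq (hl _) (fun z => hρ.commutesAt_smul c (hl ξ z))
        (by simp [hlx]) y }
  have hinj (y : M) : Function.Injective (Λ₀ y) := by
    intro ξ ζ h
    have := congrFun (hρ.isLocalSystem.eq_of_eq_at (hl ξ) (hl ζ) h) x
    rwa [hlx, hlx] at this
  let Λ (y : M) : 𝔤 ≃ₗ[ℝ] 𝔤 := LinearEquiv.ofInjectiveEndo (Λ₀ y) (hinj y)
  have hΛ (y : M) (ξ : 𝔤) : Λ y ξ = l ξ y := rfl
  have hΛlie (y : M) (ξ ζ : 𝔤) : Λ y ⁅ξ, ζ⁆ = ⁅Λ y ξ, Λ y ζ⁆ :=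
    huniq (hl _) (fun z => hρ.commutesAt_lie (hl ξ z) (hl ζ z)) (by simp [hlx]) y
  let η₀ (y : M) : TangentSpace 𝓘(ℝ, E) y →L[ℝ] ℝ := (LinearMap.toContinuousLinearMap
    (ϑ ∘ₗ (Λ y).symm.toLinearMap ∘ₗ (hρ.evalEquiv y).symm.toLinearMap) : E →L[ℝ] ℝ)
  have hη₀ (y : M) (ξ : 𝔤) : η₀ y (ρ ξ y) = ϑ ((Λ y).symm ξ) :=
    congrArg (fun ζ => ϑ ((Λ y).symm ζ)) ((hρ.evalEquiv y).symm_apply_apply ξ)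
  have hsmooth (x₀ : M) : ContDiffAt ℝ ∞ (chartForm x₀ η₀) (extChartAt 𝓘(ℝ, E) x₀ x₀) := by
    have hO := isOpen_extChartAt_target (I := 𝓘(ℝ, E)) x₀
    let κ := hρ.evalEquiv x₀
    let Λ' (z : E) : E →L[ℝ] E := LinearMap.toContinuousLinearMap (κ.toLinearMap ∘ₗ
      (Λ ((extChartAt 𝓘(ℝ, E) x₀).symm z)).toLinearMap ∘ₗ κ.symm.toLinearMap)
    have hΛ' : ContDiffOn ℝ ∞ Λ' (extChartAt 𝓘(ℝ, E) x₀).target :=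
      contDiffOn_clm_apply.2 fun a => hρ.contDiffOn_of_commutesAt (hl (κ.symm a)) x₀
    have hΛi (z : E) : (Λ' z).IsInvertible :=
      ⟨(κ.symm.trans ((Λ ((extChartAt 𝓘(ℝ, E) x₀).symm z)).trans κ)).toContinuousLinearEquiv, rfl⟩
    have h₁ := contDiffOn_inverse_frame hO hΛ' fun z _ => hΛi z
    have h₂ := contDiffOn_inverse_frame hO (hρ.contDiffOn_chartFrame x₀)
      fun z hz => hρ.isInvertible_chartFrame hz
    have h₃ : ContDiffOn ℝ ∞ (chartForm x₀ η₀) (extChartAt 𝓘(ℝ, E) x₀).target := by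
      refine ((contDiffOn_const (c := LinearMap.toContinuousLinearMap
        (ϑ ∘ₗ κ.symm.toLinearMap))).clm_comp (h₁.clm_comp h₂)).congr fun z hz => ?_
      ext v
      obtain ⟨a, rfl⟩ := (hρ.isInvertible_chartFrame hz).surjective v
      obtain ⟨b, rfl⟩ := (hΛi z).surjective a
      rw [ContinuousLinearMap.comp_apply, ContinuousLinearMap.comp_apply,
        (hρ.isInvertible_chartFrame hz).inverse_apply_self, (hΛi z).inverse_apply_self,
        chartFrame_apply, chartForm_chartField hz]
      refine (hη₀ _ _).trans ?_
      simp [Λ', κ]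
    exact h₃.contDiffAt (hO.mem_nhds (mem_extChartAt_target x₀))
  let η : SmoothOneForm E M := ⟨η₀, fun x₀ => (contMDiffAt_oneForm_iff η₀ x₀).2 (hsmooth x₀)⟩
  have hη (y : M) (ξ : 𝔤) : η y (ρ ξ y) = ϑ ((Λ y).symm ξ) := hη₀ y ξ
  refine ⟨η, (hρ.mem_conservativeContactForms_iff hk η).2 ⟨fun y => ?_, fun y ξ ζ => ?_⟩, ?_⟩
  · refine mem_contactCovectors_of_comp k (Λ y).toLinearMap (fun ξ => ?_) (fun ξ ζ => ?_) hϑ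
    · exact (hη y _).trans (congrArg ϑ ((Λ y).symm_apply_apply ξ))
    · refine (hη y _).trans ?_
      rw [LinearEquiv.coe_coe, ← hΛlie, LinearEquiv.symm_apply_apply]
  · have h₁ := (hρ.differentialAt_pairing η (hl ((Λ y).symm ζ) y)).2 ξ
    have h₂ : l ((Λ y).symm ζ) y = ζ := (Λ y).apply_symm_apply ζ
    have h₃ : (fun z => η z (ρ (l ((Λ y).symm ζ) z) z)) = fun _ => ϑ ((Λ y).symm ζ) := by
      funext z
      rw [hη, ← hΛ, LinearEquiv.symm_apply_apply]
    rw [h₂, h₃, differentialAt, mfderiv_const] at h₁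
    exact (sub_eq_zero.1 h₁.symm)
  · ext ξ
    refine (hη x ξ).trans (congrArg ϑ ?_)
    rw [LinearEquiv.symm_apply_eq, hΛ, hlx]

/-- Evaluation identifies conservative contact forms with contact covectors. -/
theorem bijOn_evalCovector [FiniteDimensional ℝ 𝔤] [PreconnectedSpace M] {k : ℕ}
    (hk : Module.finrank ℝ E = 2 * k + 1) {x : M}
    (hglob : ∀ ξ, ∃ l : M → 𝔤, l x = ξ ∧ ∀ y, CommutesAt ρ l y) :
    BijOn (evalCovector ρ x) (conservativeContactForms k (range ρ)) (contactCovectors 𝔤 k) :=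
  ⟨fun η hη => ((hρ.mem_conservativeContactForms_iff hk η).1 hη).1 x, hρ.injOn_evalCovector hk x,
    fun _ hϑ => hρ.exists_mem_conservativeContactForms hk hglob hϑ⟩

end IsLieFrame

end ConservativeContactForms

/-! ### Counting contact forms -/

section Counting

theorem nonempty_embedding_pi_real (ι : Type) [Countable ι] : Nonempty ((ι → ℝ) ↪ ℝ) := by
  rw [← Cardinal.le_def, ← Cardinal.power_def, Cardinal.mk_real]
  calc Cardinal.continuum ^ Cardinal.mk ι ≤ Cardinal.continuum ^ Cardinal.aleph0 :=
        Cardinal.power_le_power_left Cardinal.continuum_ne_zero Cardinal.mk_le_aleph0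
    _ = Cardinal.continuum := Cardinal.continuum_power_aleph0

variable {E : Type*} [NormedAddCommGroup E] [NormedSpace ℝ E] [CompleteSpace E]
variable {M : Type*} [TopologicalSpace M] [ChartedSpace E M] [IsManifold 𝓘(ℝ, E) ∞ M]
variable {𝔤 : Type*} [LieRing 𝔤] [LieAlgebra ℝ 𝔤]

namespace IsLieFrame

variable {ρ : 𝔤 →ₗ[ℝ] SmoothVectorField E M} (hρ : IsLieFrame ρ)
include hρ

theorem nonempty_embedding_oneForm [FiniteDimensional ℝ 𝔤] [SeparableSpace M] [Nonempty M] :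
    Nonempty (SmoothOneForm E M ↪ ℝ) := by
  let b := Module.finBasis ℝ 𝔤
  let f (η : SmoothOneForm E M) (p : ℕ × Fin (Module.finrank ℝ 𝔤)) : ℝ :=
    η (denseSeq M p.1) (ρ (b p.2) (denseSeq M p.1))
  have hf : Function.Injective f := by
    intro η η' h
    have key (i : Fin (Module.finrank ℝ 𝔤)) :
        (fun y => η y (ρ (b i) y)) = fun y => η' y (ρ (b i) y) := by
      refine Continuous.ext_on (denseRange_denseSeq M) (η.contMDiff_apply _).continuous
        (η'.contMDiff_apply _).continuous ?_
      rintro _ ⟨n, rfl⟩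
      exact congrFun h (n, i)
    ext y v
    obtain ⟨ξ, rfl⟩ := (hρ.bijective y).surjective v
    have : evalCovector ρ y η = evalCovector ρ y η' := b.ext fun i => congrFun (key i) y
    exact DFunLike.congr_fun this ξ
  exact (nonempty_embedding_pi_real _).map fun g => ⟨fun η => g (f η), g.injective.comp hf⟩

/-- Both sets are empty or have the cardinality of the continuum. -/
theorem nonempty_equiv_contactCovectors [FiniteDimensional ℝ 𝔤] [SeparableSpace M] {k : ℕ} {x : M}
    (h : BijOn (evalCovector ρ x) (conservativeContactForms k (range ρ)) (contactCovectors 𝔤 k)) :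
    Nonempty (hamiltonianContactForms k (range ρ) ≃ contactCovectors 𝔤 k) := by
  have : Nonempty M := ⟨x⟩
  rcases (contactCovectors 𝔤 k).eq_empty_or_nonempty with hΘ | ⟨ϑ, hϑ⟩
  · have h₁ : IsEmpty (contactCovectors 𝔤 k) := isEmpty_coe_sort.2 hΘ
    have h₂ : IsEmpty (hamiltonianContactForms (E := E) k (range ρ)) :=
      ⟨fun η => h₁.false ⟨_, hρ.evalCovector_mem_contactCovectors η.2 x⟩⟩
    exact ⟨Equiv.equivOfIsEmpty _ _⟩
  · have hϑ0 : ϑ ≠ 0 := by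
      rintro rfl
      exact hϑ (contactTopForm_zero_left k _)
    let i : ℝ ↪ contactCovectors 𝔤 k :=
      ⟨fun t => ⟨Real.exp t • ϑ, smul_mem_contactCovectors hϑ (Real.exp_ne_zero t)⟩, fun s t hst =>
        Real.exp_injective (smul_left_injective ℝ hϑ0 (Subtype.ext_iff.1 hst))⟩
    obtain ⟨j⟩ := hρ.nonempty_embedding_oneForm
    let incl (η : conservativeContactForms (E := E) k (range ρ)) :
        hamiltonianContactForms k (range ρ) :=
      ⟨η, η.2.1, fun Y hY => (η.2.2 Y hY).imp fun _ => And.left⟩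
    have hincl : Function.Injective incl := fun η η' h =>
      Subtype.ext (congrArg (Subtype.val (p := (· ∈ hamiltonianContactForms k (range ρ)))) h)
    exact Function.Embedding.antisymm
      (((Function.Embedding.subtype _).trans j).trans i)
      ((h.equiv _).symm.toEmbedding.trans ⟨incl, hincl⟩)

end IsLieFrame

end Counting

/-! ### Restriction of Lie frames, and locally automorphic Lie systems -/

section Restriction

open VectorField

variable {E : Type*} [NormedAddCommGroup E] [NormedSpace ℝ E] [CompleteSpace E]
variable {M : Type*} [TopologicalSpace M] [ChartedSpace E M] [IsManifold 𝓘(ℝ, E) ∞ M]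
variable {𝔤 : Type*} [LieRing 𝔤] [LieAlgebra ℝ 𝔤]

theorem SmoothVectorField.restrict_apply (W : Opens M) (Y : SmoothVectorField E M) (x : W) :
    (SmoothVectorField.restrict W Y x : E) = Y x.1 := by
  change (mfderiv 𝓘(ℝ, E) 𝓘(ℝ, E) (Subtype.val : W → M) x).inverse (Y x.1) = Y x.1
  rw [mfderiv_subtype_val]
  have h : (ContinuousLinearMap.id ℝ E).inverse = ContinuousLinearMap.id ℝ E :=
    ContinuousLinearMap.inverse_id
  exact DFunLike.congr_fun h (Y x.1 : E)

theorem SmoothVectorField.restrict_bracket (W : Opens M) (Y Z : SmoothVectorField E M) :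
    SmoothVectorField.restrict W ⁅Y, Z⁆ =
      ⁅SmoothVectorField.restrict W Y, SmoothVectorField.restrict W Z⁆ := by
  ext x
  have : IsManifold 𝓘(ℝ, E) (minSmoothness ℝ 3) M := by
    rw [minSmoothness_of_isRCLikeNormedField]; infer_instance
  have : IsManifold 𝓘(ℝ, E) (minSmoothness ℝ 3) W := by
    rw [minSmoothness_of_isRCLikeNormedField]; infer_instance
  exact mpullback_mlieBracket (V := Y) (W := Z) (n := ∞) (Y.mdifferentiableAt_mk _)
    (Z.mdifferentiableAt_mk _) (contMDiff_subtype_val x) (by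
      rw [minSmoothness_of_isRCLikeNormedField]
      exact WithTop.coe_le_coe.2 (le_top : (2 : ℕ∞) ≤ ⊤))

theorem IsLieFrame.restrict {ρ : 𝔤 →ₗ[ℝ] SmoothVectorField E M} (hρ : IsLieFrame ρ)
    (W : Opens M) : IsLieFrame (restrictₗ W ∘ₗ ρ) where
  map_lie ξ ζ := by
    simp only [LinearMap.comp_apply, hρ.map_lie]
    exact SmoothVectorField.restrict_bracket W _ _
  bijective x := by
    have : (fun ξ => ((restrictₗ W ∘ₗ ρ) ξ x : E)) = fun ξ => (ρ ξ x.1 : E) :=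
      funext fun ξ => SmoothVectorField.restrict_apply W (ρ ξ) x
    exact (congrArg Function.Bijective this).mpr (hρ.bijective x.1)

theorem CommutesAt.restrict {ρ : 𝔤 →ₗ[ℝ] SmoothVectorField E M} {l : M → 𝔤} {W : Opens M} {x : W}
    (hl : CommutesAt ρ l x.1) : CommutesAt (restrictₗ W ∘ₗ ρ) (fun y : W => l y) x := by
  intro c
  have hval : MDifferentiableAt 𝓘(ℝ, E) 𝓘(ℝ, E) (Subtype.val : W → M) x :=
    (contMDiff_subtype_val (n := 1) x).mdifferentiableAt (by simp)
  refine ⟨(hl c).1.comp x hval, fun ξ => ?_⟩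
  have h := mfderiv_comp x (hl c).1 hval
  rw [mfderiv_subtype_val] at h
  refine (DFunLike.congr_fun h ((restrictₗ W ∘ₗ ρ) ξ x)).trans ?_
  refine Eq.trans ?_ ((hl c).2 ξ)
  exact congrArg (differentialAt (fun y => c (l y)) x.1)
    (SmoothVectorField.restrict_apply W (ρ ξ) x)

end Restriction

section LieSystem

variable {E : Type*} [NormedAddCommGroup E] [NormedSpace ℝ E] [CompleteSpace E]
variable {M : Type*} [TopologicalSpace M] [ChartedSpace E M] [IsManifold 𝓘(ℝ, E) ∞ M]
variable {𝔤 : Type*} [LieRing 𝔤] [LieAlgebra ℝ 𝔤] {X : ℝ → SmoothVectorField E M}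

theorem range_realization (e : 𝔤 ≃ₗ⁅ℝ⁆ smallestLieAlgebra X) :
    range (realization e) = {Y | Y ∈ smallestLieAlgebra X} := by
  ext Y
  constructor
  · rintro ⟨ξ, rfl⟩
    exact (e ξ).2
  · intro hY
    exact ⟨e.symm ⟨Y, hY⟩, by simp [realization]⟩

theorem range_restrictₗ_realization (e : 𝔤 ≃ₗ⁅ℝ⁆ smallestLieAlgebra X) (W : Opens M) :
    range (restrictₗ W ∘ₗ realization e) = restrictSet W (smallestLieAlgebra X) := by
  rw [LinearMap.coe_comp, range_comp, range_realization]
  rfl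

theorem IsLocallyAutomorphic.finiteDimensional_of_equiv
    (hX : IsLocallyAutomorphic X (smallestLieAlgebra X)) (e : 𝔤 ≃ₗ⁅ℝ⁆ smallestLieAlgebra X) :
    FiniteDimensional ℝ 𝔤 :=
  have := hX.finiteDimensional
  LinearEquiv.finiteDimensional e.toLinearEquiv.symm

/-- The Vessiot–Guldberg Lie algebra of a locally automorphic Lie system is a Lie frame. -/
theorem IsLocallyAutomorphic.isLieFrame [FiniteDimensional ℝ E]
    (hX : IsLocallyAutomorphic X (smallestLieAlgebra X)) (e : 𝔤 ≃ₗ⁅ℝ⁆ smallestLieAlgebra X) :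
    IsLieFrame (realization e) where
  map_lie ξ ζ := congrArg Subtype.val (e.map_lie ξ ζ)
  bijective x := by
    have := hX.finiteDimensional_of_equiv e
    let f : 𝔤 →ₗ[ℝ] E :=
      { toFun := fun ξ => realization e ξ x
        map_add' := fun ξ ζ => by rw [map_add]; rfl
        map_smul' := fun c ξ => by rw [map_smul]; rfl }
    have hf : Function.Surjective f := by
      intro v
      obtain ⟨Y, hY, rfl⟩ := hX.distribution_eq x v
      exact ⟨e.symm ⟨Y, hY⟩, congrArg (fun Z => Z.1 x) (e.apply_symm_apply ⟨Y, hY⟩)⟩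
    have hrank : Module.finrank ℝ 𝔤 = Module.finrank ℝ E :=
      e.toLinearEquiv.finrank_eq.trans hX.finrank_eq
    exact ⟨(LinearMap.injective_iff_surjective_of_finrank_eq_finrank hrank).2 hf, hf⟩

end LieSystem

/-! ### Left-invariant vector fields -/

section LieGroup

open VectorField Filter Topology

/-- Vector fields obtained by moving vectors with the partial derivatives of a map of two variables
commute. -/
theorem lieBracket_eq_zero_of_partial {E : Type*} [NormedAddCommGroup E] [NormedSpace ℝ E]
    {f : E × E → E} {c : E} (hf : ContDiffAt ℝ 2 f (c, c)) {V W : E → E}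
    (hV : V =ᶠ[𝓝 c] fun t => fderiv ℝ (fun s => f (s, t)) c (V c))
    (hW : W =ᶠ[𝓝 c] fun s => fderiv ℝ (fun t => f (s, t)) c (W c)) :
    DifferentiableAt ℝ W c ∧ lieBracket ℝ V W c = 0 := by
  have hd : ∀ᶠ p in 𝓝 (c, c), DifferentiableAt ℝ f p :=
    (hf.eventually (by simp)).mono fun p hp => hp.differentiableAt (by simp)
  have hf' := ((hf.fderiv_right (m := 1) (le_of_eq one_add_one_eq_two)).differentiableAt
    (by simp)).hasFDerivAt
  have hV' : V =ᶠ[𝓝 c] fun t => fderiv ℝ f (c, t) (V c, 0) := by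
    have hc : ContinuousAt (fun t : E => (c, t)) c := by fun_prop
    filter_upwards [hV, hc.eventually hd] with t ht htd
    rw [ht]
    exact DFunLike.congr_fun (HasFDerivAt.comp (f := fun s => (s, t)) c htd.hasFDerivAt
      (hasFDerivAt_prodMk_left c t)).fderiv _
  have hW' : W =ᶠ[𝓝 c] fun s => fderiv ℝ f (s, c) (0, W c) := by
    have hc : ContinuousAt (fun s : E => (s, c)) c := by fun_prop
    filter_upwards [hW, hc.eventually hd] with s hs hsd
    rw [hs]
    exact DFunLike.congr_fun (HasFDerivAt.comp (f := fun t => (s, t)) c hsd.hasFDerivAt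
      (hasFDerivAt_prodMk_right s c)).fderiv _
  have hdV := (((HasFDerivAt.comp (f := fun t => (c, t)) c hf' (hasFDerivAt_prodMk_right c c)).clm_apply
    (hasFDerivAt_const (V c, (0 : E)) c))).congr_of_eventuallyEq hV'
  have hdW := (((HasFDerivAt.comp (f := fun s => (s, c)) c hf' (hasFDerivAt_prodMk_left c c)).clm_apply
    (hasFDerivAt_const ((0 : E), W c) c))).congr_of_eventuallyEq hW'
  refine ⟨hdW.differentiableAt, ?_⟩
  rw [lieBracket, hdV.fderiv, hdW.fderiv]
  have hs := hf.isSymmSndFDerivAt (by simp) (V c, 0) (0, W c)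
  simp [hs]

variable {E : Type*} [NormedAddCommGroup E] [NormedSpace ℝ E]
variable {M : Type*} [TopologicalSpace M] [ChartedSpace E M] [IsManifold 𝓘(ℝ, E) ∞ M]

/-- The coordinate expression of a relation of vectors by the differential of a map. -/
theorem chartField_map {x₀ : M} {y : E} (hy : y ∈ (extChartAt 𝓘(ℝ, E) x₀).target) {Φ : M → M}
    {V : ∀ x : M, TangentSpace 𝓘(ℝ, E) x}
    (hΦ : MDifferentiableAt 𝓘(ℝ, E) 𝓘(ℝ, E) Φ ((extChartAt 𝓘(ℝ, E) x₀).symm y))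
    (hx : Φ ((extChartAt 𝓘(ℝ, E) x₀).symm y) ∈ (extChartAt 𝓘(ℝ, E) x₀).source)
    (hV : mfderiv 𝓘(ℝ, E) 𝓘(ℝ, E) Φ ((extChartAt 𝓘(ℝ, E) x₀).symm y)
      (V ((extChartAt 𝓘(ℝ, E) x₀).symm y)) = V (Φ ((extChartAt 𝓘(ℝ, E) x₀).symm y))) :
    chartField x₀ V (extChartAt 𝓘(ℝ, E) x₀ (Φ ((extChartAt 𝓘(ℝ, E) x₀).symm y))) =
      fderiv ℝ (fun z => extChartAt 𝓘(ℝ, E) x₀ (Φ ((extChartAt 𝓘(ℝ, E) x₀).symm z)))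
        y (chartField x₀ V y) := by
  have h₁ := (contMDiffAt_extChartAt_symm_self hy).mdifferentiableAt (by simp)
  have h₂ := (contMDiffAt_extChartAt_self hx).mdifferentiableAt (by simp)
  have h₃ := mfderiv_comp (I'' := 𝓘(ℝ, E)) y h₂ (hΦ.comp y h₁)
  rw [mfderiv_comp y hΦ h₁, mfderiv_eq_fderiv] at h₃
  rw [← mfderiv_extChartAt_apply hx, ← hV, ← mfderiv_chartField hy V]
  exact (DFunLike.congr_fun h₃ (chartField x₀ V y)).symm

section FiniteDimensional

variable [FiniteDimensional ℝ E] [CompleteSpace E]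
variable {𝔤 : Type*} [LieRing 𝔤] [LieAlgebra ℝ 𝔤]

/-- A section commutes with a Lie frame if its field does so in the preferred chart. -/
theorem IsLieFrame.commutesAt_of_lieBracket_eq_zero {ρ : 𝔤 →ₗ[ℝ] SmoothVectorField E M}
    (hρ : IsLieFrame ρ) {l : M → 𝔤} {x : M}
    (h : ∀ ξ, DifferentiableAt ℝ (chartField x fun y => ρ (l y) y) (extChartAt 𝓘(ℝ, E) x x) ∧
      lieBracket ℝ (chartField x (ρ ξ)) (chartField x fun y => ρ (l y) y)
        (extChartAt 𝓘(ℝ, E) x x) = 0) : CommutesAt ρ l x := by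
  set c := extChartAt 𝓘(ℝ, E) x x
  have hc : c ∈ (extChartAt 𝓘(ℝ, E) x).target := mem_extChartAt_target x
  have hO := isOpen_extChartAt_target (I := 𝓘(ℝ, E)) x
  have hc' := hO.mem_nhds hc
  have hψ : (extChartAt 𝓘(ℝ, E) x).symm c = x := extChartAt_to_inv x
  have hinv := hρ.isInvertible_chartFrame hc
  set L := chartField x fun y => ρ (l y) y with hL
  have hLd := (h 0).1
  set u : E → E := fun z => hρ.evalEquiv x (l ((extChartAt 𝓘(ℝ, E) x).symm z)) with hu
  have hLu (z : E) : L z = hρ.chartFrame x z (u z) := by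
    rw [hu, chartFrame_apply, LinearEquiv.symm_apply_apply]
    rfl
  have hTi := ((contDiffOn_inverse_frame hO (hρ.contDiffOn_chartFrame x) fun z hz =>
    hρ.isInvertible_chartFrame hz).contDiffAt hc').differentiableAt (by simp)
  have hT := (((hρ.contDiffOn_chartFrame x).contDiffAt hc').differentiableAt (by simp))
  have hud : DifferentiableAt ℝ u c := by
    refine (hTi.clm_apply hLd).congr_of_eventuallyEq ?_
    filter_upwards [hc'] with z hz
    rw [hLu, (hρ.isInvertible_chartFrame hz).inverse_apply_self]
  have hL' := (hT.hasFDerivAt.clm_apply hud.hasFDerivAt).congr_of_eventuallyEq (.of_eq (funext hLu))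
  rw [← hψ, hρ.commutesAt_iff hc]
  refine hud.hasFDerivAt.congr_fderiv ?_
  ext v
  obtain ⟨a, rfl⟩ := hinv.surjective v
  have h₁ := (h ((hρ.evalEquiv x).symm a)).2
  have hR : fderiv ℝ (chartField x (ρ ((hρ.evalEquiv x).symm a))) c (L c) =
      fderiv ℝ (hρ.chartFrame x) c (L c) a := by
    have := (hT.hasFDerivAt.clm_apply (hasFDerivAt_const a c)).fderiv
    have h' := DFunLike.congr_fun this (L c)
    simp only [add_apply, ContinuousLinearMap.comp_apply, ContinuousLinearMap.flip_apply,
      zero_apply, map_zero, zero_add] at h'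
    exact h'
  have hf := hρ.fderiv_chartFrame hc a (u c)
  rw [lieBracket, hL'.fderiv, hR, hLu, add_apply, ContinuousLinearMap.comp_apply,
    ContinuousLinearMap.flip_apply, ← hρ.chartFrame_apply, add_sub_assoc, hf, ← map_add] at h₁
  have h₂ := hinv.injective (h₁.trans (map_zero _).symm)
  rw [eq_neg_of_add_eq_zero_left h₂, ContinuousLinearMap.comp_apply, hinv.inverse_apply_self]
  rfl

/-- A frame of right-invariant vector fields on a Lie group commutes with the left-invariant vector
fields. -/
theorem IsLieFrame.exists_commutesAt_of_isRightInvariantField {ρ : 𝔤 →ₗ[ℝ] SmoothVectorField E M}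
    (hρ : IsLieFrame ρ) [Group M] [LieGroup 𝓘(ℝ, E) ∞ M]
    (hinv : ∀ ξ, IsRightInvariantField (ρ ξ)) (x : M) (ξ : 𝔤) :
    ∃ l : M → 𝔤, l x = ξ ∧ ∀ y, CommutesAt ρ l y := by
  have hleft (g p : M) : MDifferentiableAt 𝓘(ℝ, E) 𝓘(ℝ, E) (fun m : M => g * m) p :=
    ((contMDiff_mul_left (I := 𝓘(ℝ, E)) (n := ∞) (a := g)) p).mdifferentiableAt (by simp)
  have hright (g p : M) : MDifferentiableAt 𝓘(ℝ, E) 𝓘(ℝ, E) (fun m : M => m * g) p :=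
    ((contMDiff_mul_right (I := 𝓘(ℝ, E)) (n := ∞) (a := g)) p).mdifferentiableAt (by simp)
  let L₀ (y : M) : E := mfderiv 𝓘(ℝ, E) 𝓘(ℝ, E) (fun m : M => y * x⁻¹ * m) x (ρ ξ x)
  let L (y : M) : TangentSpace 𝓘(ℝ, E) y := L₀ y
  have hLinv (g y : M) : mfderiv 𝓘(ℝ, E) 𝓘(ℝ, E) (fun m : M => g * m) y (L y) = L (g * y) := by
    have h₁ := mfderiv_comp (I'' := 𝓘(ℝ, E)) x (hleft g (y * x⁻¹ * x)) (hleft (y * x⁻¹) x)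
    have h₂ : (fun m : M => g * m) ∘ (fun m : M => y * x⁻¹ * m) = fun m => g * y * x⁻¹ * m := by
      funext m
      simp only [Function.comp_apply, mul_assoc]
    rw [h₂] at h₁
    refine Eq.trans ?_ (DFunLike.congr_fun h₁ (ρ ξ x)).symm
    exact congrArg (fun q => (mfderiv 𝓘(ℝ, E) 𝓘(ℝ, E) (fun m : M => g * m) q : E →L[ℝ] E) (L₀ y))
      (inv_mul_cancel_right y x).symm
  let l (y : M) : 𝔤 := (hρ.evalEquiv y).symm (L y)
  have hl (y : M) : ρ (l y) y = L y := (hρ.evalEquiv y).apply_symm_apply (L y)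
  refine ⟨l, ?_, fun y => hρ.commutesAt_of_lieBracket_eq_zero fun ζ => ?_⟩
  · have h₁ : L₀ x = ρ ξ x := by
      have h₂ : (fun m : M => x * x⁻¹ * m) = id := by
        funext m
        rw [mul_inv_cancel, one_mul, id]
      have h₃ : ∀ φ : M → M, φ = id → (mfderiv 𝓘(ℝ, E) 𝓘(ℝ, E) φ x (ρ ξ x) : E) = ρ ξ x := by
        rintro _ rfl
        rw [mfderiv_id]
        rfl
      exact h₃ _ h₂
    exact ((hρ.evalEquiv x).symm_apply_eq).2 h₁
  set c := extChartAt 𝓘(ℝ, E) y y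
  have hc : c ∈ (extChartAt 𝓘(ℝ, E) y).target := mem_extChartAt_target y
  have hc' := (isOpen_extChartAt_target (I := 𝓘(ℝ, E)) y).mem_nhds hc
  have hψ : (extChartAt 𝓘(ℝ, E) y).symm c = y := extChartAt_to_inv y
  have hV : (fun y => ρ (l y) y) = L := funext hl
  rw [hV]
  let f (p : E × E) : E := extChartAt 𝓘(ℝ, E) y ((extChartAt 𝓘(ℝ, E) y).symm p.1 * y⁻¹ *
    (extChartAt 𝓘(ℝ, E) y).symm p.2)
  refine lieBracket_eq_zero_of_partial (f := f) ?_ ?_ ?_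
  · have hcc : (extChartAt 𝓘(ℝ, E) y).symm c * y⁻¹ * (extChartAt 𝓘(ℝ, E) y).symm c = y := by
      rw [hψ, mul_inv_cancel, one_mul]
    have h₁ : ContMDiffAt 𝓘(ℝ, E × E) 𝓘(ℝ, E) ∞
        (fun p : E × E => (extChartAt 𝓘(ℝ, E) y).symm p.1) (c, c) :=
      (contMDiffAt_extChartAt_symm_self hc).comp (c, c) contDiff_fst.contMDiff.contMDiffAt
    have h₂ : ContMDiffAt 𝓘(ℝ, E × E) 𝓘(ℝ, E) ∞
        (fun p : E × E => (extChartAt 𝓘(ℝ, E) y).symm p.2) (c, c) :=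
      (contMDiffAt_extChartAt_symm_self hc).comp (c, c) contDiff_snd.contMDiff.contMDiffAt
    have h₃ : ContMDiffAt 𝓘(ℝ, E × E) 𝓘(ℝ, E) ∞ f (c, c) :=
      ContMDiffAt.comp (c, c) (contMDiffAt_extChartAt_self (by
        simp only [hcc]
        exact mem_extChartAt_source y)) ((h₁.mul contMDiffAt_const).mul h₂)
    exact h₃.contDiffAt.of_le (WithTop.coe_le_coe.2 (le_top : (2 : ℕ∞) ≤ ⊤))
  · filter_upwards [hc'] with t ht
    have h := chartField_map (x₀ := y) hc (V := ρ ζ)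
      (hright (y⁻¹ * (extChartAt 𝓘(ℝ, E) y).symm t) _) (by
        rw [hψ, mul_inv_cancel_left]
        exact (extChartAt 𝓘(ℝ, E) y).map_target ht) (hinv ζ _ _)
    simp only [hψ, mul_inv_cancel_left, (extChartAt 𝓘(ℝ, E) y).right_inv ht] at h
    simpa only [f, mul_assoc] using h
  · filter_upwards [hc'] with s hs
    have h := chartField_map (x₀ := y) hc (V := L)
      (hleft ((extChartAt 𝓘(ℝ, E) y).symm s * y⁻¹) _) (by
        rw [hψ, inv_mul_cancel_right]
        exact (extChartAt 𝓘(ℝ, E) y).map_target hs) (hLinv _ _)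
    simp only [hψ, inv_mul_cancel_right, (extChartAt 𝓘(ℝ, E) y).right_inv hs] at h
    exact h

end FiniteDimensional

end LieGroup

theorem mainTheorem4 (k : ℕ) {M : Type*} [TopologicalSpace M] [T2Space M]
    [SecondCountableTopology M] [ConnectedSpace M]
    [ChartedSpace (EuclideanSpace ℝ (Fin (2 * k + 1))) M] [IsManifold (𝓡 (2 * k + 1)) ∞ M]
    (X : ℝ → SmoothVectorField (EuclideanSpace ℝ (Fin (2 * k + 1))) M)
    (hX : IsLocallyAutomorphic X (smallestLieAlgebra X))
    {𝔤 : Type*} [LieRing 𝔤] [LieAlgebra ℝ 𝔤] (e : 𝔤 ≃ₗ⁅ℝ⁆ smallestLieAlgebra X) :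
    -- simply connected manifolds and automorphic Lie systems
    (SimplyConnectedSpace M ∨ IsRightInvariantAlgebra (smallestLieAlgebra X) →
      (∀ x : M, BijOn (evalCovector (realization e) x)
        (conservativeContactForms k {Y | Y ∈ smallestLieAlgebra X})
        (contactCovectors 𝔤 k)) ∧
      Nonempty
        (hamiltonianContactForms k {Y | Y ∈ smallestLieAlgebra X} ≃
          contactCovectors 𝔤 k)) ∧
    -- arbitrary manifolds, locally
    (∀ x₀ : M, ∃ U : Opens M, x₀ ∈ U ∧ ∀ W : Opens M, W ≤ U → ConnectedSpace W →
      (∀ x : W, BijOn (evalCovector (restrictₗ W ∘ₗ realization e) x)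
        (conservativeContactForms k
          (restrictSet W (smallestLieAlgebra X)))
        (contactCovectors 𝔤 k)) ∧
      Nonempty
        (hamiltonianContactForms k
          (restrictSet W (smallestLieAlgebra X)) ≃
          contactCovectors 𝔤 k)) ∧
    -- arbitrary manifolds, globally
    (∀ x : M,
      MapsTo (evalCovector (realization e) x)
        (hamiltonianContactForms k {Y | Y ∈ smallestLieAlgebra X})
        (contactCovectors 𝔤 k) ∧
      InjOn (evalCovector (realization e) x)
        (conservativeContactForms k {Y | Y ∈ smallestLieAlgebra X})) := by
  have := hX.finiteDimensional_of_equiv e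
  have hρ := hX.isLieFrame e
  have hk : Module.finrank ℝ (EuclideanSpace ℝ (Fin (2 * k + 1))) = 2 * k + 1 := by simp
  rw [← range_realization e]
  refine ⟨fun h => ?_, fun x₀ => ?_, fun x =>
    ⟨fun η hη => hρ.evalCovector_mem_contactCovectors hη x, hρ.injOn_evalCovector hk x⟩⟩
  · have hglob (x : M) (ξ : 𝔤) :
        ∃ l : M → 𝔤, l x = ξ ∧ ∀ y, CommutesAt (realization e) l y := by
      rcases h with h | ⟨_, _, h⟩
      · have := ChartedSpace.locallyPathConnectedSpace (EuclideanSpace ℝ (Fin (2 * k + 1))) M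
        exact hρ.isLocalSystem.exists_section_of_simplyConnectedSpace x ξ
      · exact hρ.exists_commutesAt_of_isRightInvariantField (fun ζ => (h _).1 (e ζ).2) x ξ
    have hbij (x : M) := hρ.bijOn_evalCovector hk (hglob x)
    obtain ⟨x⟩ := (inferInstance : Nonempty M)
    exact ⟨hbij, hρ.nonempty_equiv_contactCovectors (hbij x)⟩
  · obtain ⟨U, -, hx₀, hU⟩ := hρ.isLocalSystem.trivialized x₀ univ Filter.univ_mem
    refine ⟨⟨U, hU.isOpen⟩, hx₀, fun W hW _ => ?_⟩
    rw [← range_restrictₗ_realization e W]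
    have hbij (x : W) := (hρ.restrict W).bijOn_evalCovector hk (x := x) fun ξ => by
      obtain ⟨l, hl, hl'⟩ := hU.exists_section x (hW x.2) ξ
      exact ⟨fun y => l y, hl, fun y => (hl' y (hW y.2)).restrict⟩
    obtain ⟨x⟩ := (inferInstance : Nonempty W)
    exact ⟨hbij, (hρ.restrict W).nonempty_equiv_contactCovectors (hbij x)⟩
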